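/- Let $k$ be an algebraically closed field, let $n\ge 1$ and $d\ge 0$ be integers, and assume that $\operatorname{char} k=0$ or $\operatorname{char} k>d$. Let $S=k[[\alpha_1,\dots,\alpha_n]]$. For $a\in\mathbb{N}_0^n$ let $x^{[a]}\colon S\to k$ be the functional taking the coefficient of $\alpha^a$, and let $P_{\le d}$ be the vector space spanned by the $x^{[a]}$ with $a_1+\dots+a_n\le d$, equipped with the Zariski topology of an affine space. Say that $f\in P_{\le d}$ has degree $d$ if $f$ does not lie in the span of the $x^{[a]}$ with $a_1+\dots+a_n\le d-1$. For $f\in P_{\le d}$ and $\sigma\in S$ let $\sigma\lrcorner f$ be the functional $\tau\mapsto f(\tau\sigma)$, let $\operatorname{Ann}(f)=\{\sigma\in S : \sigma\lrcorner f=0\}$, and let $\operatorname{Apolar}(f)=S/\operatorname{Ann}(f)$; $f$ is called a dual socle generator of this algebra. A local $k$-algebra $(A,\mathfrak{m})$ is canonically graded if it is isomorphic as a $k$-algebra to its associated graded algebra $\operatorname{gr}A=\bigoplus_{i\ge 0}\mathfrak{m}^i/\mathfrak{m}^{i+1}$, and its socle degree is $\max\{i : \mathfrak{m}^i\neq 0\}$.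 Let $\mathcal{G}\subseteq P_{\le d}$ be the set of dual socle generators of canonically graded local algebras of socle degree $d$, that is, the set of those $f\in P_{\le d}$ for which $\operatorname{Apolar}(f)$ is local, canonically graded and of socle degree $d$. Then $\mathcal{G}$ is irreducible (in particular non-empty) and constructible, but in general it is neither open nor closed: 1. if $n=2$ and $d=5$, then $\mathcal{G}$ is not closed in $P_{\le d}$; moreover, it is not even closed in the set of elements of degree $d$: there is an $f\in P_{\le d}$ of degree $d$ which lies in the closure of $\mathcal{G}$ but not in $\mathcal{G}$; 2. if $n=2$ and $d\ge 9$, then $\mathcal{G}$ is not open in $P_{\le d}$. -/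

import Mathlib

noncomputable section

namespace CanonicallyGraded

section AssociatedGraded

variable (k : Type*) [Field k] (A : Type*) [CommRing A] [IsLocalRing A] [Algebra k A]

/-- Inside the Rees algebra `⨁ i, 𝔪 ^ i t ^ i` of the maximal ideal `𝔪` of `A`,
the ideal `⨁ i, 𝔪 ^ (i + 1) t ^ i`. -/
def reesShift : Ideal (reesAlgebra (IsLocalRing.maximalIdeal A)) where
  carrier := {p | ∀ i, (p : Polynomial A).coeff i ∈ IsLocalRing.maximalIdeal A ^ (i + 1)}
  add_mem' {p q} hp hq i := by
    simpa using Ideal.add_mem _ (hp i) (hq i)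
  zero_mem' i := by simp
  smul_mem' c p hp i := by
    rw [smul_eq_mul, MulMemClass.coe_mul, Polynomial.coeff_mul]
    refine Ideal.sum_mem _ fun x hx => ?_
    rw [← Finset.HasAntidiagonal.mem_antidiagonal.mp hx, add_assoc, pow_add]
    exact Ideal.mul_mem_mul (c.2 x.1) (hp x.2)

/-- The associated graded algebra `gr A = ⨁ i, 𝔪 ^ i / 𝔪 ^ (i + 1)` of a local ring `A`, realised
as the quotient of `⨁ i, 𝔪 ^ i t ^ i` by the ideal `⨁ i, 𝔪 ^ (i + 1) t ^ i`. -/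
abbrev Gr : Type _ := reesAlgebra (IsLocalRing.maximalIdeal A) ⧸ reesShift A

/-- A local `k`-algebra is canonically graded if it is isomorphic, as a `k`-algebra, to its
associated graded algebra. -/
def IsCanonicallyGraded : Prop := Nonempty (A ≃ₐ[k] Gr A)

/-- `d` is the socle degree of `A`: the largest `i` with `𝔪 ^ i ≠ 0`. -/
def HasSocleDegree (d : ℕ) : Prop :=
  IsGreatest {i : ℕ | IsLocalRing.maximalIdeal A ^ i ≠ ⊥} d

end AssociatedGraded

section Apolarity

variable (k : Type*) [Field k] (n : ℕ)

/-- The power series ring `S = k[[α₁, …, αₙ]]`. -/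
abbrev S : Type _ := MvPowerSeries (Fin n) k

/-- The divided power monomial `x^[a]`: the functional on `S` dual to the monomial `α ^ a`, that is,
the functional taking the coefficient of `α ^ a`. -/
def dpMonomial (a : Fin n →₀ ℕ) : Module.Dual k (S k n) := MvPowerSeries.coeff a

/-- The space `P_{≤ d}` of divided power polynomials of degree at most `d`: the span of
the `x^[a]` with `a₁ + ⋯ + aₙ ≤ d`. -/
def PLE (d : ℕ) : Submodule k (Module.Dual k (S k n)) :=
  Submodule.span k (dpMonomial k n '' {a | a.degree ≤ d})

variable {k n}

/-- The contraction `σ ⌟ f`, given by `⟨τ, σ ⌟ f⟩ = ⟨τ σ, f⟩`. -/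
def contract (σ : S k n) (f : Module.Dual k (S k n)) : Module.Dual k (S k n) :=
  f ∘ₗ LinearMap.mulRight k σ

/-- The apolar ideal `Ann f = {σ | σ ⌟ f = 0}`. -/
def Ann (f : Module.Dual k (S k n)) : Ideal (S k n) where
  carrier := {σ | contract σ f = 0}
  add_mem' {σ τ} hσ hτ := by
    have h : contract (σ + τ) f = contract σ f + contract τ f := by
      ext x; simp [contract, mul_add]
    rw [Set.mem_ofPred_eq, h, hσ, hτ, add_zero]
  zero_mem' := by ext x; simp [contract]
  smul_mem' c σ hσ := by
    ext x
    have h := LinearMap.congr_fun hσ (x * c)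
    simpa [contract, mul_assoc] using h

/-- The apolar algebra `S / Ann f`; `f` is a dual socle generator of it. -/
abbrev Apolar (f : Module.Dual k (S k n)) : Type _ := S k n ⧸ Ann f

end Apolarity

/-- The Zariski topology of a finite-dimensional vector space `V`, regarded as an affine space: the
non-vanishing loci of polynomial functions (polynomials in linear functionals) form a basis. -/
abbrev zariskiTopology (k : Type*) [Field k] (V : Type*) [AddCommGroup V] [Module k V] :
    TopologicalSpace V :=
  TopologicalSpace.generateFrom
    {U | ∃ p : MvPolynomial (Module.Dual k V) k,
      U = {v | MvPolynomial.eval (fun l : Module.Dual k V => l v) p ≠ 0}}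

instance instTopologicalSpacePLE (k : Type*) [Field k] (n d : ℕ) : TopologicalSpace (PLE k n d) :=
  zariskiTopology k (PLE k n d)

/-- The set of those `f ∈ P_{≤ d}` which are dual socle generators of canonically graded local
algebras of socle degree `d`. The zero ring, which is the apolar algebra of `0`, is not local. -/
def canGradedLocus (k : Type*) [Field k] (n d : ℕ) : Set (PLE k n d) :=
  {f | ∃ _ : IsLocalRing (Apolar (f : Module.Dual k (S k n))),
    IsCanonicallyGraded k (Apolar (f : Module.Dual k (S k n))) ∧
      HasSocleDegree (Apolar (f : Module.Dual k (S k n))) d}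

end CanonicallyGraded

end

/-!
The apolar algebra of `f` is canonically graded of socle degree `d` if and only if `f` is in the
orbit of a nonzero form of degree `d` under automorphisms of the power series ring and contractions
by units: lifting a grading along a change of coordinates makes the apolar ideal homogeneous, and a
homogeneous apolar ideal also annihilates the top degree form `F` of `f`, so that `f` is a unit
multiple of `F`. The locus is therefore the image, under a polynomial map, of an open subset of an
affine space, which is irreducible and, by Chevalley's theorem, constructible.

A linear form which, in top degree, annihilates an element of this orbit can be straightened to a
linear form annihilating `F`; its powers then only see higher order corrections. This excludes
`x ^ [d] + t y ^ [d - 1]` for `t ≠ 0` from the locus. On the other hand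
`x ^ [d] + y ^ [d - 1] + s y ^ [d]` is the contraction of `x ^ [d] + s y ^ [d]` by the unit
`1 + s⁻¹ β` whenever `s ≠ 0`. Letting `s`, respectively `t`, tend to `0` shows that the locus is
neither closed nor open.
-/

noncomputable section

namespace CanonicallyGraded

open MvPowerSeries IsLocalRing Finset.HasAntidiagonal

section PowerSeries

variable {σ R : Type*}

section Homogeneous

variable [CommSemiring R]

theorem homogeneousComponent_homogeneousComponent (i j : ℕ) (s : MvPowerSeries σ R) :
    homogeneousComponent i (homogeneousComponent j s) =
      if i = j then homogeneousComponent j s else 0 := by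
  ext a
  by_cases hij : i = j
  · subst hij
    rw [if_pos rfl, coeff_homogeneousComponent, coeff_homogeneousComponent]
    split_ifs <;> rfl
  · rw [if_neg hij, coeff_homogeneousComponent, coeff_homogeneousComponent, map_zero]
    split_ifs with hi hj
    · exact absurd (hi.symm.trans hj) hij
    all_goals rfl

theorem homogeneousComponent_one (j : ℕ) :
    homogeneousComponent j (1 : MvPowerSeries σ R) = if j = 0 then 1 else 0 := by
  classical
  ext a
  rw [coeff_homogeneousComponent, coeff_one]
  by_cases ha : a = 0
  · subst ha
    by_cases hj : j = 0 <;> simp [hj, eq_comm]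
  · by_cases hj : j = 0 <;> simp [hj, ha, coeff_one]

theorem homogeneousComponent_mul (j : ℕ) (s t : MvPowerSeries σ R) :
    homogeneousComponent j (s * t) = ∑ p ∈ antidiagonal j,
      homogeneousComponent p.1 s * homogeneousComponent p.2 t := by
  classical
  ext a
  simp_rw [coeff_homogeneousComponent, map_sum, coeff_mul, coeff_homogeneousComponent]
  rw [Finset.sum_comm, Finset.ite_sum_zero]
  refine Finset.sum_congr rfl fun q hq => ?_
  have hdeg : a.degree = q.1.degree + q.2.degree := by rw [← mem_antidiagonal.1 hq, map_add]
  simp_rw [ite_zero_mul_ite_zero, ← Prod.ext_iff (x := (q.1.degree, q.2.degree))]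
  rw [Finset.sum_ite_eq]
  simp_rw [mem_antidiagonal, hdeg]

theorem homogeneousComponent_homogeneousComponent_mul (i j : ℕ) (s t : MvPowerSeries σ R) :
    homogeneousComponent i (homogeneousComponent j s * t) =
      if j ≤ i then homogeneousComponent j s * homogeneousComponent (i - j) t else 0 := by
  simp_rw [homogeneousComponent_mul, homogeneousComponent_homogeneousComponent, ite_zero_mul]
  split_ifs with hji
  · rw [Finset.sum_eq_single (j, i - j)]
    · exact if_pos rfl
    · intro p hp hne
      refine if_neg fun hpj => hne (Prod.ext hpj ?_)
      have := mem_antidiagonal.1 hp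
      simp only
      omega
    · exact fun h => absurd (mem_antidiagonal.2 (Nat.add_sub_cancel' hji)) h
  · refine Finset.sum_eq_zero fun p hp => if_neg fun hpj => hji ?_
    exact hpj ▸ (mem_antidiagonal.1 hp ▸ Nat.le_add_right _ _)

theorem homogeneousComponent_eq_zero_of_lt_order {i : ℕ} {s : MvPowerSeries σ R}
    (h : (i : ℕ∞) < s.order) : homogeneousComponent i s = 0 := by
  ext a
  rw [coeff_homogeneousComponent, map_zero]
  split_ifs with ha
  · exact coeff_of_lt_order (ha ▸ h)
  · rfl

theorem natCast_le_order_homogeneousComponent (j : ℕ) (s : MvPowerSeries σ R) :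
    (j : ℕ∞) ≤ (homogeneousComponent j s).order :=
  nat_le_order fun a ha => by rw [coeff_homogeneousComponent, if_neg ha.ne]

end Homogeneous

variable [CommRing R]

theorem natCast_le_order_sub_sum_homogeneousComponent (j : ℕ) (s : MvPowerSeries σ R) :
    (j : ℕ∞) ≤ (s - ∑ i ∈ Finset.range j, homogeneousComponent i s).order := by
  refine nat_le_order fun a ha => ?_
  simp_rw [map_sub, map_sum, coeff_homogeneousComponent]
  rw [Finset.sum_ite_eq, if_pos (Finset.mem_range.2 ha), sub_self]

theorem natCast_le_order_of_mem_span_range_X_pow {j : ℕ} {s : MvPowerSeries σ R}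
    (hs : s ∈ Ideal.span (Set.range X) ^ j) : (j : ℕ∞) ≤ s.order := by
  induction j generalizing s with
  | zero => exact zero_le
  | succ j ih =>
    rw [pow_succ] at hs
    refine Submodule.mul_induction_on hs (fun x hx y hy => ?_) fun x y hx hy =>
      (le_min hx hy).trans min_order_le_add
    have hy0 : constantCoeff y = 0 := by
      have hle : Ideal.span (Set.range X) ≤ RingHom.ker (constantCoeff (σ := σ) (R := R)) := by
        rw [Ideal.span_le]
        rintro _ ⟨i, rfl⟩
        exact constantCoeff_X i
      exact hle hy
    push_cast
    exact (add_le_add (ih hx) (one_le_order_iff_constCoeff_eq_zero.2 hy0)).trans le_order_mul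

theorem exists_eq_sum_X_mul [Fintype σ] {j : ℕ} {s : MvPowerSeries σ R}
    (hs : ((j + 1 : ℕ) : ℕ∞) ≤ s.order) :
    ∃ q : σ → MvPowerSeries σ R, s = ∑ i, X i * q i ∧ ∀ i, (j : ℕ∞) ≤ (q i).order := by
  classical
  have hvar : ∀ a : σ →₀ ℕ, a ≠ 0 → ∃ i, a i ≠ 0 := fun a ha => by
    simpa only [ne_eq, Finsupp.coe_zero, Pi.zero_apply] using Finsupp.ne_iff.1 ha
  choose var hvar using hvar
  -- Sort the monomials of `s` by a variable chosen to divide them.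
  let part (i : σ) : MvPowerSeries σ R := fun a => if ∃ ha, var a ha = i then coeff a s else 0
  have coeff_part (i : σ) (a : σ →₀ ℕ) :
      coeff a (part i) = if ∃ ha, var a ha = i then coeff a s else 0 := rfl
  have hdvd (i : σ) : X i ∣ part i := by
    refine X_dvd_iff.2 fun a ha => ?_
    rw [coeff_part, if_neg]
    rintro ⟨h, rfl⟩
    exact hvar a h ha
  choose q hq using hdvd
  refine ⟨q, ?_, fun i => nat_le_order fun a ha => ?_⟩
  · ext a
    simp_rw [← hq, map_sum, coeff_part]
    by_cases ha : a = 0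
    · rw [ha, coeff_of_lt_order (lt_of_lt_of_le (by simp) hs)]
      simp
    · simp [ha]
  · have hcoeff : coeff (Finsupp.single i 1 + a) (part i) = coeff a (q i) := by
      rw [hq, X, coeff_add_monomial_mul, one_mul]
    rw [← hcoeff, coeff_part, coeff_of_lt_order (lt_of_lt_of_le _ hs), ite_self]
    rw [map_add, Finsupp.degree_single]
    exact_mod_cast (by omega)

theorem mem_span_range_X_pow_iff [Finite σ] {j : ℕ} {s : MvPowerSeries σ R} :
    s ∈ Ideal.span (Set.range X) ^ j ↔ (j : ℕ∞) ≤ s.order := by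
  cases nonempty_fintype σ
  refine ⟨natCast_le_order_of_mem_span_range_X_pow, fun hs => ?_⟩
  induction j generalizing s with
  | zero => simp
  | succ j ih =>
    obtain ⟨q, rfl, hq⟩ := exists_eq_sum_X_mul hs
    rw [pow_succ']
    exact Ideal.sum_mem _ fun i _ =>
      Ideal.mul_mem_mul (Ideal.subset_span ⟨i, rfl⟩) (ih (hq i))

end PowerSeries

section LocalRing

variable {σ k : Type*} [Field k]

theorem mem_maximalIdeal_iff {s : MvPowerSeries σ k} :
    s ∈ maximalIdeal (MvPowerSeries σ k) ↔ constantCoeff s = 0 := by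
  rw [mem_maximalIdeal, mem_nonunits_iff, isUnit_iff_constantCoeff, isUnit_iff_ne_zero, not_not]

theorem X_mem_maximalIdeal (i : σ) : (X i : MvPowerSeries σ k) ∈ maximalIdeal (MvPowerSeries σ k) :=
  mem_maximalIdeal_iff.2 (constantCoeff_X i)

variable [Finite σ]

theorem maximalIdeal_eq_span_range_X :
    maximalIdeal (MvPowerSeries σ k) = Ideal.span (Set.range X) := by
  ext s
  rw [mem_maximalIdeal_iff, ← pow_one (Ideal.span _), mem_span_range_X_pow_iff, Nat.cast_one,
    one_le_order_iff_constCoeff_eq_zero]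

theorem mem_maximalIdeal_pow_iff {j : ℕ} {s : MvPowerSeries σ k} :
    s ∈ maximalIdeal (MvPowerSeries σ k) ^ j ↔ (j : ℕ∞) ≤ s.order := by
  rw [maximalIdeal_eq_span_range_X, mem_span_range_X_pow_iff]

theorem coeff_eq_zero_of_mem_maximalIdeal_pow {j : ℕ} {s : MvPowerSeries σ k}
    (hs : s ∈ maximalIdeal (MvPowerSeries σ k) ^ j) {a : σ →₀ ℕ} (ha : a.degree < j) :
    coeff a s = 0 :=
  coeff_of_lt_order (lt_of_lt_of_le (by exact_mod_cast ha) (mem_maximalIdeal_pow_iff.1 hs))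

theorem homogeneousComponent_eq_zero_of_mem {i j : ℕ} (hij : i < j) {s : MvPowerSeries σ k}
    (hs : s ∈ maximalIdeal (MvPowerSeries σ k) ^ j) : homogeneousComponent i s = 0 :=
  homogeneousComponent_eq_zero_of_lt_order
    (lt_of_lt_of_le (by exact_mod_cast hij) (mem_maximalIdeal_pow_iff.1 hs))

theorem homogeneousComponent_mem (j : ℕ) (s : MvPowerSeries σ k) :
    homogeneousComponent j s ∈ maximalIdeal (MvPowerSeries σ k) ^ j :=
  mem_maximalIdeal_pow_iff.2 (natCast_le_order_homogeneousComponent j s)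

theorem sub_sum_homogeneousComponent_mem (j : ℕ) (s : MvPowerSeries σ k) :
    s - ∑ i ∈ Finset.range j, homogeneousComponent i s ∈ maximalIdeal (MvPowerSeries σ k) ^ j :=
  mem_maximalIdeal_pow_iff.2 (natCast_le_order_sub_sum_homogeneousComponent j s)

theorem sub_homogeneousComponent_mem {j : ℕ} {s : MvPowerSeries σ k}
    (hs : s ∈ maximalIdeal (MvPowerSeries σ k) ^ j) :
    s - homogeneousComponent j s ∈ maximalIdeal (MvPowerSeries σ k) ^ (j + 1) := by
  have hlow : ∑ i ∈ Finset.range j, homogeneousComponent i s = 0 :=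
    Finset.sum_eq_zero fun i hi => homogeneousComponent_eq_zero_of_mem (Finset.mem_range.1 hi) hs
  simpa only [Finset.sum_range_succ, hlow, zero_add] using
    sub_sum_homogeneousComponent_mem (j + 1) s

end LocalRing

section FormalAutomorphisms

variable {σ k : Type*}

/-- The Jacobian matrix at the origin of the tuple of power series `b`, that is, the matrix of
coefficients of the linear parts of its entries. -/
def jacobian [Semiring k] (b : σ → MvPowerSeries σ k) : Matrix σ σ k :=
  Matrix.of fun i j => coeff (Finsupp.single j 1) (b i)

variable [Field k]

theorem homogeneousComponent_one_eq_sum [Fintype σ] (s : MvPowerSeries σ k) :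
    homogeneousComponent 1 s = ∑ i, coeff (Finsupp.single i 1) s • (X i : MvPowerSeries σ k) := by
  classical
  ext a
  simp_rw [coeff_homogeneousComponent, map_sum, coeff_smul, coeff_X]
  split_ifs with ha
  · obtain ⟨i, rfl⟩ := Finsupp.range_single_one.ge ha
    simp [Finsupp.single_left_inj]
  · refine (Finset.sum_eq_zero fun i _ => ?_).symm
    rw [if_neg, mul_zero]
    rintro rfl
    exact ha (Finsupp.degree_single i 1)

theorem coeff_single_mul [Finite σ] (c : MvPowerSeries σ k) {b : MvPowerSeries σ k}
    (hb : b ∈ maximalIdeal (MvPowerSeries σ k)) (i : σ) :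
    coeff (Finsupp.single i 1) (c * b) = constantCoeff c * coeff (Finsupp.single i 1) b := by
  have hc : c - C (constantCoeff c) ∈ maximalIdeal (MvPowerSeries σ k) := by
    rw [mem_maximalIdeal_iff, map_sub, constantCoeff_C, sub_self]
  have hmem : (c - C (constantCoeff c)) * b ∈ maximalIdeal (MvPowerSeries σ k) ^ 2 :=
    pow_two (maximalIdeal (MvPowerSeries σ k)) ▸ Ideal.mul_mem_mul hc hb
  have h := coeff_eq_zero_of_mem_maximalIdeal_pow hmem (a := Finsupp.single i 1) (by simp)
  rwa [sub_mul, map_sub, coeff_C_mul, sub_eq_zero] at h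

theorem jacobian_X [DecidableEq σ] : jacobian (X : σ → MvPowerSeries σ k) = 1 := by
  ext i j
  simp [jacobian, coeff_X, Matrix.one_apply, Finsupp.single_left_inj, eq_comm]

theorem injective_of_surjective_of_isNoetherianRing {R : Type*} [CommRing R] [IsNoetherianRing R]
    {f : R →+* R} (hf : Function.Surjective f) : Function.Injective f := by
  have hmono : Monotone fun n => RingHom.ker (f ^ n) := monotone_nat_of_le_succ fun n x hx => by
    rw [RingHom.mem_ker] at hx ⊢
    rw [pow_succ', RingHom.mul_def, RingHom.comp_apply, hx, map_zero]
  obtain ⟨n, hn⟩ := monotone_stabilizes_iff_noetherian.2 ‹IsNoetherianRing R› ⟨_, hmono⟩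
  have hsurj : Function.Surjective (f ^ n) := by
    rw [RingHom.coe_pow]
    exact hf.iterate n
  refine (injective_iff_map_eq_zero f).2 fun x hx => ?_
  obtain ⟨y, rfl⟩ := hsurj x
  have hker : RingHom.ker (f ^ n) = RingHom.ker (f ^ (n + 1)) := hn (n + 1) n.le_succ
  rw [← RingHom.mem_ker, hker, RingHom.mem_ker, pow_succ', RingHom.mul_def, RingHom.comp_apply, hx]

theorem bijective_of_map_maximalIdeal_eq [Finite σ] {φ : MvPowerSeries σ k →ₐ[k] MvPowerSeries σ k}
    (hφ : (maximalIdeal (MvPowerSeries σ k)).map φ = maximalIdeal (MvPowerSeries σ k)) :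
    Function.Bijective φ := by
  have hsurj : Function.Surjective (φ : MvPowerSeries σ k →+* MvPowerSeries σ k) := by
    have hcomplete : IsAdicComplete (maximalIdeal (MvPowerSeries σ k)) (MvPowerSeries σ k) := by
      rw [maximalIdeal_eq_span_range_X]
      infer_instance
    have : IsHausdorff ((maximalIdeal (MvPowerSeries σ k)).map
        (φ : MvPowerSeries σ k →+* MvPowerSeries σ k)) (MvPowerSeries σ k) :=
      hφ.symm ▸ hcomplete.toIsHausdorff
    refine surjective_of_mk_map_comp_surjective (I := maximalIdeal (MvPowerSeries σ k)) _ ?_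
    refine Ideal.Quotient.mk_surjective.forall.2 fun s =>
      ⟨algebraMap k _ (constantCoeff s), ?_⟩
    rw [RingHom.comp_apply, Ideal.Quotient.eq]
    refine hφ.ge (mem_maximalIdeal_iff.2 ?_)
    rw [RingHom.coe_coe, φ.commutes, map_sub, MvPowerSeries.algebraMap_apply, constantCoeff_C,
      Algebra.algebraMap_self, RingHom.id_apply, sub_self]
  exact ⟨injective_of_surjective_of_isNoetherianRing hsurj, hsurj⟩

variable [Fintype σ] [DecidableEq σ] {b : σ → MvPowerSeries σ k}

theorem det_jacobian_ne_zero (hb : Ideal.span (Set.range b) = maximalIdeal (MvPowerSeries σ k)) :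
    (jacobian b).det ≠ 0 := by
  have hbm (i : σ) : b i ∈ maximalIdeal (MvPowerSeries σ k) := hb ▸ Ideal.subset_span ⟨i, rfl⟩
  have hX (i : σ) : ∃ c : σ → MvPowerSeries σ k, ∑ j, c j * b j = X i := by
    rw [← Ideal.mem_span_range_iff_exists_fun, hb]
    exact X_mem_maximalIdeal i
  choose c hc using hX
  have hmul : Matrix.of (fun i j => constantCoeff (c i j)) * jacobian b = 1 := by
    rw [← jacobian_X]
    ext i l
    simp_rw [Matrix.mul_apply, jacobian, Matrix.of_apply, ← coeff_single_mul _ (hbm _), ← map_sum,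
      hc]
  exact Matrix.det_ne_zero_of_left_inverse hmul

theorem span_range_eq_maximalIdeal (hb : ∀ i, b i ∈ maximalIdeal (MvPowerSeries σ k))
    (hdet : (jacobian b).det ≠ 0) :
    Ideal.span (Set.range b) = maximalIdeal (MvPowerSeries σ k) := by
  refine le_antisymm (Ideal.span_le.2 (Set.range_subset_iff.2 hb)) ?_
  -- By Nakayama's lemma it suffices to work modulo the square of the maximal ideal.
  refine Submodule.le_of_le_smul_of_le_jacobson_bot (IsNoetherian.noetherian _)
    (maximalIdeal_le_jacobson _) ?_
  conv_lhs => rw [maximalIdeal_eq_span_range_X]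
  rw [Ideal.span_le, Set.range_subset_iff]
  intro i
  have hlin : (X i : MvPowerSeries σ k) =
      ∑ j, (jacobian b)⁻¹ i j • homogeneousComponent 1 (b j) := by
    simp_rw [homogeneousComponent_one_eq_sum, Finset.smul_sum, smul_smul]
    rw [Finset.sum_comm]
    have hinv (l : σ) : ∑ j, (jacobian b)⁻¹ i j * coeff (Finsupp.single l 1) (b j) =
        if i = l then 1 else 0 := by
      have h := congrFun₂ (Matrix.nonsing_inv_mul (jacobian b) hdet.isUnit) i l
      rwa [Matrix.mul_apply, Matrix.one_apply] at h
    simp_rw [← Finset.sum_smul, hinv, ite_smul, one_smul, zero_smul]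
    rw [Finset.sum_ite_eq, if_pos (Finset.mem_univ i)]
  have hsplit : (X i : MvPowerSeries σ k) =
      ∑ j, (jacobian b)⁻¹ i j • b j +
        ∑ j, -(jacobian b)⁻¹ i j • (b j - homogeneousComponent 1 (b j)) := by
    rw [hlin, ← Finset.sum_add_distrib]
    exact Finset.sum_congr rfl fun j _ => by module
  rw [hsplit]
  refine Submodule.add_mem_sup (Submodule.sum_mem _ fun j _ => ?_)
    (Submodule.sum_mem _ fun j _ => ?_)
  · exact Submodule.smul_of_tower_mem _ _ (Ideal.subset_span ⟨j, rfl⟩)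
  · rw [smul_eq_mul, ← pow_two]
    exact Submodule.smul_of_tower_mem _ _ (sub_homogeneousComponent_mem (by simpa using hb j))

theorem exists_algEquiv_X_iff : (∃ φ : MvPowerSeries σ k ≃ₐ[k] MvPowerSeries σ k,
      ∀ i, φ (X i) = b i) ↔ (∀ i, constantCoeff (b i) = 0) ∧ (jacobian b).det ≠ 0 := by
  have hspan {φ : MvPowerSeries σ k →ₐ[k] MvPowerSeries σ k} (hφ : ∀ i, φ (X i) = b i) :
      (maximalIdeal (MvPowerSeries σ k)).map φ = Ideal.span (Set.range b) := by
    rw [maximalIdeal_eq_span_range_X, Ideal.map_span, ← Set.range_comp]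
    exact congrArg (fun c => Ideal.span (Set.range c)) (funext hφ)
  refine ⟨?_, fun ⟨hb, hdet⟩ => ?_⟩
  · rintro ⟨φ, hφ⟩
    have hmap : Ideal.span (Set.range b) = maximalIdeal (MvPowerSeries σ k) := by
      rw [← hspan (φ := (φ : MvPowerSeries σ k →ₐ[k] MvPowerSeries σ k)) hφ]
      exact map_maximalIdeal_of_surjective (φ : MvPowerSeries σ k →+* MvPowerSeries σ k)
        φ.surjective
    exact ⟨fun i => mem_maximalIdeal_iff.1 (hmap ▸ Ideal.subset_span ⟨i, rfl⟩),
      det_jacobian_ne_zero hmap⟩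
  · let φ := substAlgHom (R := k) (hasSubst_of_constantCoeff_zero hb)
    have hφ (i : σ) : φ (X i) = b i := substAlgHom_X _ i
    have hmap := (hspan hφ).trans
      (span_range_eq_maximalIdeal (fun i => mem_maximalIdeal_iff.2 (hb i)) hdet)
    exact ⟨AlgEquiv.ofBijective φ (bijective_of_map_maximalIdeal_eq hmap), hφ⟩

end FormalAutomorphisms

section LocalRingHom

variable {R A : Type*} [CommRing R] [IsLocalRing R] [CommRing A] [IsLocalRing A] {F : Type*}
  [FunLike F R A] [RingHomClass F R A] {π : F}

theorem map_maximalIdeal_pow (hπ : Function.Surjective π) (j : ℕ) :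
    (maximalIdeal R ^ j).map π = maximalIdeal A ^ j := by
  rw [Ideal.map_pow]
  exact congrArg (· ^ j) (map_maximalIdeal_of_surjective (π : R →+* A) hπ)

theorem map_mem_maximalIdeal_pow (hπ : Function.Surjective π) {j : ℕ} {r : R}
    (hr : r ∈ maximalIdeal R ^ j) : π r ∈ maximalIdeal A ^ j :=
  map_maximalIdeal_pow hπ j ▸ Ideal.mem_map_of_mem _ hr

theorem exists_of_mem_maximalIdeal_pow (hπ : Function.Surjective π) {j : ℕ} {x : A}
    (hx : x ∈ maximalIdeal A ^ j) : ∃ r ∈ maximalIdeal R ^ j, π r = x := by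
  rw [← map_maximalIdeal_pow hπ] at hx
  exact (Ideal.mem_map_iff_of_surjective π hπ).1 hx

theorem maximalIdeal_pow_eq_bot_iff (hπ : Function.Surjective π) (j : ℕ) :
    maximalIdeal A ^ j = ⊥ ↔ maximalIdeal R ^ j ≤ RingHom.ker π := by
  rw [← map_maximalIdeal_pow hπ, Ideal.map_eq_bot_iff_le_ker]

theorem hasSocleDegree_iff (hπ : Function.Surjective π) {d : ℕ} : HasSocleDegree A d ↔
    ¬ maximalIdeal R ^ d ≤ RingHom.ker π ∧ maximalIdeal R ^ (d + 1) ≤ RingHom.ker π := by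
  simp_rw [← maximalIdeal_pow_eq_bot_iff hπ]
  refine and_congr_right fun _ => ⟨fun h => ?_, fun h i hi => ?_⟩
  · by_contra hne
    exact absurd (h hne) (Nat.not_succ_le_self d)
  · by_contra! hlt
    exact hi (le_bot_iff.1 (h ▸ Ideal.pow_le_pow_right hlt))

end LocalRingHom

section Expansion

variable {σ k : Type*} [Finite σ] [Field k] {A : Type*} [CommRing A] [IsLocalRing A] [Algebra k A]
  {π : MvPowerSeries σ k →ₐ[k] A} {d : ℕ}

/-- An ideal of the power series ring is homogeneous if it contains the homogeneous components of
all its elements. -/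
def IsHomogeneousIdeal (J : Ideal (MvPowerSeries σ k)) : Prop :=
  ∀ s ∈ J, ∀ j, homogeneousComponent j s ∈ J

theorem IsHomogeneousIdeal.homogeneousComponent_mem_of_sub_mem
    {J : Ideal (MvPowerSeries σ k)} (hJ : IsHomogeneousIdeal J)
    {j : ℕ} {s t : MvPowerSeries σ k} (hst : homogeneousComponent j s - t ∈ J)
    (ht : t ∈ maximalIdeal (MvPowerSeries σ k) ^ (j + 1)) : homogeneousComponent j s ∈ J := by
  have h := hJ _ hst j
  rwa [map_sub, homogeneousComponent_homogeneousComponent, if_pos rfl,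
    homogeneousComponent_eq_zero_of_mem j.lt_succ_self ht, sub_zero] at h

/-- The polynomial with coefficients in `A` whose coefficient of degree `j ≤ d` is the image under
`π` of the homogeneous component of degree `j` of a given power series. -/
def expansionPolynomial (π : MvPowerSeries σ k →ₐ[k] A) (d : ℕ) :
    MvPowerSeries σ k →ₗ[k] Polynomial A :=
  ∑ i ∈ Finset.range (d + 1),
    (Polynomial.monomial i).restrictScalars k ∘ₗ π.toLinearMap ∘ₗ homogeneousComponent i

theorem coeff_expansionPolynomial (hπ : Function.Surjective π) (hd : maximalIdeal A ^ (d + 1) = ⊥)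
    (s : MvPowerSeries σ k) (j : ℕ) :
    (expansionPolynomial π d s).coeff j = π (homogeneousComponent j s) := by
  simp_rw [expansionPolynomial, LinearMap.sum_apply, LinearMap.comp_apply,
    LinearMap.restrictScalars_apply, Polynomial.finsetSum_coeff, Polynomial.coeff_monomial,
    Finset.sum_ite_eq', AlgHom.toLinearMap_apply]
  refine ite_eq_left_iff.2 fun hj => ?_
  rw [Finset.mem_range, not_lt] at hj
  exact ((maximalIdeal_pow_eq_bot_iff hπ _).1 hd
    (Ideal.pow_le_pow_right hj (homogeneousComponent_mem j s))).symm

/-- For a presentation `π` of a local algebra `A` with `𝔪 ^ (d + 1) = 0`, the homomorphism from the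
power series ring to the Rees algebra of `𝔪` which records the homogeneous component of degree `j`
of a series as a multiple of `t ^ j`. -/
def expansion (hπ : Function.Surjective π) (hd : maximalIdeal A ^ (d + 1) = ⊥) :
    MvPowerSeries σ k →ₐ[k] reesAlgebra (maximalIdeal A) :=
  AlgHom.codRestrict
    (AlgHom.ofLinearMap (expansionPolynomial π d)
      (Polynomial.ext fun j => by
        rw [coeff_expansionPolynomial hπ hd, homogeneousComponent_one, Polynomial.coeff_one,
          apply_ite π, map_one, map_zero])
      (fun s t => Polynomial.ext fun j => by
        simp_rw [Polynomial.coeff_mul, coeff_expansionPolynomial hπ hd, homogeneousComponent_mul,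
          map_sum, map_mul]))
    ((reesAlgebra (maximalIdeal A)).restrictScalars k)
    fun s => (mem_reesAlgebra_iff _ _).2 fun j => (coeff_expansionPolynomial hπ hd s j).symm ▸
      map_mem_maximalIdeal_pow hπ (homogeneousComponent_mem j s)

theorem coeff_expansion (hπ : Function.Surjective π) (hd : maximalIdeal A ^ (d + 1) = ⊥)
    (s : MvPowerSeries σ k) (j : ℕ) :
    (expansion hπ hd s : Polynomial A).coeff j = π (homogeneousComponent j s) :=
  coeff_expansionPolynomial hπ hd s j

theorem mk_expansion_surjective (hπ : Function.Surjective π) (hd : maximalIdeal A ^ (d + 1) = ⊥) :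
    Function.Surjective ((Ideal.Quotient.mkₐ k (reesShift A)).comp (expansion hπ hd)) := by
  intro y
  obtain ⟨p, rfl⟩ := Ideal.Quotient.mk_surjective y
  have hlift (j : ℕ) : ∃ s ∈ maximalIdeal (MvPowerSeries σ k) ^ j,
      π s = (p : Polynomial A).coeff j :=
    exists_of_mem_maximalIdeal_pow hπ ((mem_reesAlgebra_iff _ _).1 p.2 j)
  choose s hs hsp using hlift
  refine ⟨∑ i ∈ Finset.range (d + 1), homogeneousComponent i (s i), ?_⟩
  refine (Ideal.Quotient.eq (I := reesShift A)).2 fun j => ?_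
  rw [AddSubgroupClass.coe_sub, Polynomial.coeff_sub, RingHom.coe_coe, coeff_expansion, map_sum]
  simp_rw [homogeneousComponent_homogeneousComponent, Finset.sum_ite_eq]
  rw [← hsp j, ← map_sub]
  split_ifs with hj
  · refine map_mem_maximalIdeal_pow hπ ?_
    exact (neg_sub (s j) _) ▸ neg_mem (sub_homogeneousComponent_mem (hs j))
  · rw [Finset.mem_range, not_lt] at hj
    have hzero : π (s j) = 0 :=
      (maximalIdeal_pow_eq_bot_iff hπ _).1 hd (Ideal.pow_le_pow_right hj (hs j))
    rw [zero_sub, map_neg, hzero, neg_zero]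
    exact zero_mem _

theorem mem_ker_mk_expansion (hπ : Function.Surjective π) (hd : maximalIdeal A ^ (d + 1) = ⊥)
    (s : MvPowerSeries σ k) :
    s ∈ RingHom.ker ((Ideal.Quotient.mkₐ k (reesShift A)).comp (expansion hπ hd)) ↔
      ∀ j, π (homogeneousComponent j s) ∈ maximalIdeal A ^ (j + 1) := by
  refine (Ideal.Quotient.eq_zero_iff_mem (I := reesShift A)).trans (forall_congr' fun j => ?_)
  rw [RingHom.coe_coe, coeff_expansion]

theorem IsCanonicallyGraded.exists_isHomogeneousIdeal_ker (h : IsCanonicallyGraded k A)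
    (hπ : Function.Surjective π) (hd : maximalIdeal A ^ (d + 1) = ⊥) :
    ∃ ρ : MvPowerSeries σ k →ₐ[k] A,
      Function.Surjective ρ ∧ IsHomogeneousIdeal (RingHom.ker ρ) := by
  obtain ⟨ψ⟩ := h
  refine ⟨(ψ.symm : Gr A →ₐ[k] A).comp
    ((Ideal.Quotient.mkₐ k (reesShift A)).comp (expansion hπ hd)),
    ψ.symm.surjective.comp (mk_expansion_surjective hπ hd), ?_⟩
  have hker (s : MvPowerSeries σ k) : s ∈ RingHom.ker ((ψ.symm : Gr A →ₐ[k] A).comp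
      ((Ideal.Quotient.mkₐ k (reesShift A)).comp (expansion hπ hd))) ↔
      ∀ j, π (homogeneousComponent j s) ∈ maximalIdeal A ^ (j + 1) := by
    rw [← mem_ker_mk_expansion hπ hd]
    exact map_eq_zero_iff ψ.symm ψ.symm.injective
  intro s hs i
  rw [hker] at hs ⊢
  intro j
  rw [homogeneousComponent_homogeneousComponent]
  split_ifs with hji
  · exact hji ▸ hs j
  · rw [map_zero]
    exact zero_mem _

theorem isCanonicallyGraded_of_isHomogeneousIdeal_ker (hπ : Function.Surjective π)
    (hd : maximalIdeal A ^ (d + 1) = ⊥) (hker : IsHomogeneousIdeal (RingHom.ker π)) :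
    IsCanonicallyGraded k A := by
  have hπd := (maximalIdeal_pow_eq_bot_iff hπ _).1 hd
  have hker_eq : RingHom.ker π =
      RingHom.ker ((Ideal.Quotient.mkₐ k (reesShift A)).comp (expansion hπ hd)) := by
    ext s
    rw [mem_ker_mk_expansion]
    refine ⟨fun hs j => ?_, fun hs => ?_⟩
    · rw [(RingHom.mem_ker).1 (hker s hs j)]
      exact zero_mem _
    · have hcomp (j : ℕ) : homogeneousComponent j s ∈ RingHom.ker π := by
        obtain ⟨t, ht, hts⟩ := exists_of_mem_maximalIdeal_pow hπ (hs j)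
        refine hker.homogeneousComponent_mem_of_sub_mem ?_ ht
        rw [RingHom.mem_ker, map_sub, hts, sub_self]
      rw [← sub_add_cancel s (∑ i ∈ Finset.range (d + 1), homogeneousComponent i s)]
      exact add_mem (hπd (sub_sum_homogeneousComponent_mem _ s))
        (Ideal.sum_mem _ fun i _ => hcomp i)
  exact ⟨(Ideal.quotientKerAlgEquivOfSurjective hπ).symm.trans
    ((Ideal.quotientEquivAlgOfEq k hker_eq).trans
      (Ideal.quotientKerAlgEquivOfSurjective (mk_expansion_surjective hπ hd)))⟩

end Expansion

section Presentations

theorem exists_linearEquiv_of_range_eq {K V W : Type*} [Field K] [AddCommGroup V] [Module K V]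
    [AddCommGroup W] [Module K W] [FiniteDimensional K V] {p q : V →ₗ[K] W}
    (h : LinearMap.range p = LinearMap.range q) : ∃ e : V ≃ₗ[K] V, ∀ v, q (e v) = p v := by
  obtain ⟨C, hC⟩ := (LinearMap.ker p).exists_isCompl
  obtain ⟨D, hD⟩ := (LinearMap.ker q).exists_isCompl
  have hfinrank : Module.finrank K (LinearMap.ker p) = Module.finrank K (LinearMap.ker q) := by
    have hp := p.finrank_range_add_finrank_ker
    have hq := q.finrank_range_add_finrank_ker
    rw [h] at hp
    omega
  let kerEquiv := LinearEquiv.ofFinrankEq _ _ hfinrank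
  let complEquiv : C ≃ₗ[K] D := (p.kerComplementEquivRange hC.symm).trans
    ((LinearEquiv.ofEq _ _ h).trans (q.kerComplementEquivRange hD.symm).symm)
  have hcompl (c : C) : q (complEquiv c) = p c :=
    congrArg Subtype.val (LinearEquiv.apply_symm_apply (q.kerComplementEquivRange hD.symm) _)
  refine ⟨(Submodule.prodEquivOfIsCompl _ _ hC).symm.trans
    ((kerEquiv.prodCongr complEquiv).trans (Submodule.prodEquivOfIsCompl _ _ hD)), fun v => ?_⟩
  obtain ⟨⟨x, c⟩, rfl⟩ := (Submodule.prodEquivOfIsCompl _ _ hC).surjective v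
  simp [hcompl]

variable {σ k A : Type*} [Field k] [CommRing A] [Algebra k A]

theorem algHom_ext_of_pow_le_ker [Finite σ] {φ ψ : MvPowerSeries σ k →ₐ[k] A} {j : ℕ}
    (hφ : maximalIdeal (MvPowerSeries σ k) ^ j ≤ RingHom.ker φ)
    (hψ : maximalIdeal (MvPowerSeries σ k) ^ j ≤ RingHom.ker ψ) (h : ∀ i, φ (X i) = ψ (X i)) :
    φ = ψ := by
  have htrunc {χ : MvPowerSeries σ k →ₐ[k] A}
      (hχ : maximalIdeal (MvPowerSeries σ k) ^ j ≤ RingHom.ker χ) (s : MvPowerSeries σ k) :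
      χ s = χ (s.truncTotal j) := by
    rw [← sub_eq_zero, ← map_sub, truncTotal_eq_sum]
    exact hχ (sub_sum_homogeneousComponent_mem j s)
  have hpoly : φ.comp (MvPolynomial.coeToMvPowerSeries.algHom k) =
      ψ.comp (MvPolynomial.coeToMvPowerSeries.algHom k) :=
    MvPolynomial.algHom_ext fun i => by simpa using h i
  ext s
  rw [htrunc hφ, htrunc hψ]
  simpa using DFunLike.congr_fun hpoly (s.truncTotal j)

variable [IsLocalRing A] {π ρ : MvPowerSeries σ k →ₐ[k] A}

theorem exists_sub_sum_smul_mem [Fintype σ] (hπ : Function.Surjective π) {x : A}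
    (hx : x ∈ maximalIdeal A) : ∃ c : σ → k, x - ∑ i, c i • π (X i) ∈ maximalIdeal A ^ 2 := by
  rw [← pow_one (maximalIdeal A)] at hx
  obtain ⟨s, hs, rfl⟩ := exists_of_mem_maximalIdeal_pow hπ hx
  refine ⟨fun i => coeff (Finsupp.single i 1) s, ?_⟩
  have h := map_mem_maximalIdeal_pow hπ (sub_homogeneousComponent_mem hs)
  simpa only [homogeneousComponent_one_eq_sum, map_sub, map_sum, map_smul] using h

theorem exists_matrix [Fintype σ] [DecidableEq σ] (hπ : Function.Surjective π)
    (hρ : Function.Surjective ρ) : ∃ M : Matrix σ σ k, M.det ≠ 0 ∧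
      ∀ i, π (X i) - ∑ j, M i j • ρ (X j) ∈ maximalIdeal A ^ 2 := by
  let N : Submodule k A := (maximalIdeal A ^ 2).restrictScalars k
  let L (χ : MvPowerSeries σ k →ₐ[k] A) : (σ → k) →ₗ[k] A ⧸ N :=
    N.mkQ ∘ₗ Fintype.linearCombination k fun i => χ (X i)
  -- The range of `L χ` is the cotangent space `𝔪 / 𝔪 ^ 2`, whatever the presentation `χ`.
  have hrange {χ : MvPowerSeries σ k →ₐ[k] A} (hχ : Function.Surjective χ) :
      LinearMap.range (L χ) = ((maximalIdeal A).restrictScalars k).map N.mkQ := by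
    refine le_antisymm ?_ ?_
    · rintro _ ⟨c, rfl⟩
      refine ⟨_, Ideal.sum_mem _ fun i _ => Submodule.smul_of_tower_mem _ (c i) ?_, rfl⟩
      rw [← pow_one (maximalIdeal A)]
      exact map_mem_maximalIdeal_pow hχ (by simpa using X_mem_maximalIdeal i)
    · rintro _ ⟨x, hx, rfl⟩
      obtain ⟨c, hc⟩ := exists_sub_sum_smul_mem hχ hx
      exact ⟨c, ((Submodule.Quotient.eq N).2 hc).symm⟩
  obtain ⟨e, he⟩ := exists_linearEquiv_of_range_eq ((hrange hπ).trans (hrange hρ).symm)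
  refine ⟨(LinearMap.toMatrix' (e : (σ → k) →ₗ[k] σ → k)).transpose, ?_, fun i => ?_⟩
  · rw [Matrix.det_transpose, LinearMap.det_toMatrix']
    exact (LinearEquiv.isUnit_det' e).ne_zero
  · have h := (Submodule.Quotient.eq N).1 (he (Pi.single i 1)).symm
    simpa [Pi.single_apply, LinearMap.toMatrix'_apply, Fintype.linearCombination_apply, N] using h

theorem exists_algEquiv_comp_eq [Finite σ] (hπ : Function.Surjective π)
    (hρ : Function.Surjective ρ) {d : ℕ} (hd : maximalIdeal A ^ d = ⊥) :
    ∃ φ : MvPowerSeries σ k ≃ₐ[k] MvPowerSeries σ k, ρ.comp φ = π := by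
  classical
  have := Fintype.ofFinite σ
  obtain ⟨M, hM, hMπ⟩ := exists_matrix hπ hρ
  choose r hr hρr using fun i => exists_of_mem_maximalIdeal_pow hρ (hMπ i)
  have hjacobian : jacobian (fun i => ∑ j, M i j • X j + r i) = M := by
    ext i j
    rw [jacobian, Matrix.of_apply, map_add,
      coeff_eq_zero_of_mem_maximalIdeal_pow (hr i) (by simp), add_zero, map_sum]
    simp [coeff_X, Finsupp.single_left_inj]
  have hconst (i : σ) : constantCoeff (∑ j, M i j • X j + r i) = 0 := by
    rw [← mem_maximalIdeal_iff]
    exact add_mem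
      (Ideal.sum_mem _ fun j _ => Submodule.smul_of_tower_mem _ _ (X_mem_maximalIdeal j))
      (Ideal.pow_le_self two_ne_zero (hr i))
  obtain ⟨φ, hφ⟩ := exists_algEquiv_X_iff.2 ⟨hconst, hjacobian.symm ▸ hM⟩
  have hsurj : Function.Surjective
      (ρ.comp (φ : MvPowerSeries σ k →ₐ[k] MvPowerSeries σ k)) := hρ.comp φ.surjective
  refine ⟨φ, algHom_ext_of_pow_le_ker ((maximalIdeal_pow_eq_bot_iff hsurj d).1 hd)
    ((maximalIdeal_pow_eq_bot_iff hπ d).1 hd) fun i => ?_⟩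
  change ρ (φ (X i)) = π (X i)
  rw [hφ, map_add, hρr, map_sum, add_comm]
  simp_rw [map_smul, sub_add_cancel]

end Presentations

section Functionals

variable {k : Type*} [Field k] {n d : ℕ} {f : Module.Dual k (S k n)}

/-- The exponents of the monomials of degree at most `d`, which index a basis of `P_{≤ d}`. -/
abbrev Exponent (n d : ℕ) : Type := {a : Fin n →₀ ℕ // a.degree ≤ d}

instance : Finite (Exponent n d) := Finsupp.finite_of_degree_le d

instance : Fintype (Exponent n d) := Fintype.ofFinite _

instance : FiniteDimensional k (PLE k n d) :=
  FiniteDimensional.span_of_finite k ((Finsupp.finite_of_degree_le d).image _)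

theorem sub_sum_monomial_mem (d : ℕ) (s : S k n) :
    s - ∑ a : Exponent n d, monomial a.1 (coeff a.1 s) ∈ maximalIdeal (S k n) ^ (d + 1) := by
  classical
  rw [mem_maximalIdeal_pow_iff]
  refine le_order fun a ha => ?_
  have had : a.degree ≤ d := Nat.lt_succ_iff.1 (by exact_mod_cast ha)
  rw [map_sub, map_sum, Finset.sum_eq_single (⟨a, had⟩ : Exponent n d), coeff_monomial_same,
    sub_self]
  · exact fun b _ hb => coeff_monomial_ne (fun hab => hb (Subtype.ext hab.symm)) _
  · exact fun h => absurd (Finset.mem_univ _) h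

theorem eq_sum_dpMonomial (hf : ∀ s ∈ maximalIdeal (S k n) ^ (d + 1), f s = 0) :
    f = ∑ a : Exponent n d, f (monomial a.1 1) • dpMonomial k n a.1 := by
  ext s
  have h := hf _ (sub_sum_monomial_mem d s)
  rw [map_sub, sub_eq_zero, map_sum] at h
  rw [h, LinearMap.sum_apply]
  refine Finset.sum_congr rfl fun a _ => ?_
  rw [LinearMap.smul_apply, smul_eq_mul, mul_comm, dpMonomial, ← smul_eq_mul, ← map_smul,
    ← map_smul, smul_eq_mul, mul_one]

theorem mem_PLE_iff : f ∈ PLE k n d ↔ ∀ s ∈ maximalIdeal (S k n) ^ (d + 1), f s = 0 := by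
  refine ⟨fun hf s hs => ?_, fun hf => ?_⟩
  · refine (LinearMap.mem_ker (f := LinearMap.applyₗ s)).1 (Submodule.span_le.2 ?_ hf)
    rintro _ ⟨a, ha, rfl⟩
    exact coeff_eq_zero_of_mem_maximalIdeal_pow hs (Nat.lt_succ_of_le ha)
  · rw [eq_sum_dpMonomial hf]
    exact Submodule.sum_mem _ fun a _ =>
      Submodule.smul_mem _ _ (Submodule.subset_span ⟨a.1, a.2, rfl⟩)

theorem mem_Ann {s : S k n} : s ∈ Ann f ↔ ∀ t, f (t * s) = 0 :=
  ⟨fun h t => LinearMap.congr_fun h t, fun h => LinearMap.ext h⟩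

theorem mem_PLE_iff_pow_le_Ann : f ∈ PLE k n d ↔ maximalIdeal (S k n) ^ (d + 1) ≤ Ann f := by
  rw [mem_PLE_iff]
  refine ⟨fun h s hs => mem_Ann.2 fun t => h _ (Ideal.mul_mem_left _ t hs), fun h s hs => ?_⟩
  rw [← one_mul s]
  exact mem_Ann.1 (h hs) 1

theorem contract_one : contract 1 f = f := LinearMap.ext fun s => congrArg f (mul_one s)

theorem contract_contract (s t : S k n) : contract s (contract t f) = contract (s * t) f :=
  LinearMap.ext fun r => congrArg f (mul_assoc r s t)

theorem Ann_contract {u : S k n} (hu : IsUnit u) : Ann (contract u f) = Ann f := by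
  obtain ⟨u, rfl⟩ := hu
  ext s
  simp_rw [mem_Ann]
  refine ⟨fun h t => ?_, fun h t => ?_⟩
  · have hinv : f (t * ↑u⁻¹ * s * u) = 0 := h _
    rwa [mul_right_comm, Units.inv_mul_cancel_right] at hinv
  · change f (t * s * u) = 0
    rw [mul_right_comm]
    exact h _

theorem mem_Ann_comp_algEquiv {φ : S k n ≃ₐ[k] S k n} {s : S k n} :
    s ∈ Ann (f ∘ₗ φ.toLinearMap) ↔ φ s ∈ Ann f := by
  rw [mem_Ann, mem_Ann, φ.surjective.forall (p := fun t => f (t * φ s) = 0)]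
  exact forall_congr' fun t => by rw [← map_mul]; rfl

theorem exists_eq_contract {F : Module.Dual k (S k n)} (hf : f ∈ PLE k n d)
    (hF : ∀ s ∈ Ann f, F s = 0) : ∃ u, F = contract u f := by
  let W : Submodule k (Module.Dual k (S k n)) :=
    LinearMap.range ((LinearMap.mul k (S k n)).flip.compr₂ f)
  have hW : W ≤ PLE k n d := by
    rintro _ ⟨u, rfl⟩
    exact mem_PLE_iff.2 fun s hs => mem_PLE_iff.1 hf _ (Ideal.mul_mem_right _ _ hs)
  have : FiniteDimensional k W := Submodule.finiteDimensional_of_le hW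
  have hFW : F ∈ W := by
    rw [← Subspace.dualCoannihilator_dualAnnihilator_eq (W := W), Submodule.mem_dualAnnihilator]
    intro s hs
    rw [Submodule.mem_dualCoannihilator] at hs
    refine hF s (mem_Ann.2 fun t => ?_)
    rw [mul_comm]
    exact hs _ ⟨t, rfl⟩
  obtain ⟨u, hu⟩ := hFW
  exact ⟨u, hu.symm⟩

end Functionals

section TwistedForms

variable {k : Type*} [Field k] {n d : ℕ} {f F : Module.Dual k (S k n)}

/-- A functional is a form of degree `d` if it only depends on the homogeneous component of degree
`d`, that is, if it is a combination of the `x^[a]` with `|a| = d`. -/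
def IsForm (d : ℕ) (F : Module.Dual k (S k n)) : Prop :=
  ∀ s, F (homogeneousComponent d s) = F s

theorem IsForm.mem_PLE (hF : IsForm d F) : F ∈ PLE k n d := mem_PLE_iff.2 fun s hs => by
  rw [← hF, homogeneousComponent_eq_zero_of_mem d.lt_succ_self hs, map_zero]

theorem IsForm.not_pow_le_Ann (hF : IsForm d F) (hF0 : F ≠ 0) :
    ¬ maximalIdeal (S k n) ^ d ≤ Ann F := fun h => hF0 <| LinearMap.ext fun s => by
  rw [← hF, ← one_mul (homogeneousComponent d s), LinearMap.zero_apply]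
  exact mem_Ann.1 (h (homogeneousComponent_mem d s)) 1

theorem IsForm.isHomogeneousIdeal_Ann (hF : IsForm d F) : IsHomogeneousIdeal (Ann F) := by
  refine fun s hs j => mem_Ann.2 fun t => ?_
  rw [mul_comm, ← hF, homogeneousComponent_homogeneousComponent_mul]
  split_ifs with hj
  · have h := homogeneousComponent_homogeneousComponent_mul d (d - j) t s
    rw [if_pos (Nat.sub_le d j), Nat.sub_sub_self hj] at h
    rw [mul_comm, ← h, hF]
    exact mem_Ann.1 hs _
  · exact map_zero F

/-- The orbit of the nonzero forms of degree `d` under the group generated by the automorphisms of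
the power series ring and by the contractions by its units. -/
def IsTwistedForm (d : ℕ) (f : Module.Dual k (S k n)) : Prop :=
  ∃ (φ : S k n ≃ₐ[k] S k n) (u : S k n) (F : Module.Dual k (S k n)),
    IsUnit u ∧ IsForm d F ∧ F ≠ 0 ∧ f = contract u F ∘ₗ φ.toLinearMap

theorem exists_eq_contract_isForm (hf : f ∈ PLE k n d) (hfd : ¬ maximalIdeal (S k n) ^ d ≤ Ann f)
    (hhom : IsHomogeneousIdeal (Ann f)) :
    ∃ u F, IsUnit u ∧ IsForm d F ∧ F ≠ 0 ∧ f = contract u F := by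
  obtain ⟨w, hw, hfw⟩ : ∃ w ∈ maximalIdeal (S k n) ^ d, f w ≠ 0 := by
    obtain ⟨s, hs, hsf⟩ := SetLike.not_le_iff_exists.1 hfd
    obtain ⟨t, ht⟩ := not_forall.1 (mt mem_Ann.2 hsf)
    exact ⟨t * s, Ideal.mul_mem_left _ _ hs, ht⟩
  have hF (s : S k n) (hs : s ∈ Ann f) : (f ∘ₗ homogeneousComponent d) s = 0 := by
    simpa using mem_Ann.1 (hhom s hs d) 1
  have hform : IsForm d (f ∘ₗ homogeneousComponent d) := fun s => by
    rw [LinearMap.comp_apply, homogeneousComponent_homogeneousComponent, if_pos rfl,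
      LinearMap.comp_apply]
  have hFw : (f ∘ₗ homogeneousComponent d) w = f w := by
    have h := mem_PLE_iff.1 hf _ (sub_homogeneousComponent_mem hw)
    rw [map_sub, sub_eq_zero] at h
    exact h.symm
  obtain ⟨v, hv⟩ := exists_eq_contract hf hF
  have hunit : IsUnit v := by
    by_contra hmem
    have hwv : w * v ∈ maximalIdeal (S k n) ^ (d + 1) := Ideal.mul_mem_mul hw hmem
    exact hfw (by rw [← hFw, hv]; exact mem_PLE_iff.1 hf _ hwv)
  refine ⟨↑hunit.unit⁻¹, _, Units.isUnit _, hform, fun h => hfw ?_, ?_⟩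
  · rw [← hFw, h, LinearMap.zero_apply]
  · rw [hv, contract_contract, hunit.val_inv_mul, contract_one]

theorem IsTwistedForm.exists_presentation (h : IsTwistedForm d f) :
    ∃ π : S k n →ₐ[k] Apolar f, Function.Surjective π ∧ IsHomogeneousIdeal (RingHom.ker π) ∧
      ¬ maximalIdeal (S k n) ^ d ≤ RingHom.ker π ∧
      maximalIdeal (S k n) ^ (d + 1) ≤ RingHom.ker π := by
  obtain ⟨φ, u, F, hu, hF, hF0, rfl⟩ := h
  let π := (Ideal.Quotient.mkₐ k (Ann (contract u F ∘ₗ φ.toLinearMap))).comp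
    (φ.symm : S k n →ₐ[k] S k n)
  have hker : RingHom.ker π = Ann F := by
    ext s
    refine Ideal.Quotient.eq_zero_iff_mem.trans (mem_Ann_comp_algEquiv.trans ?_)
    rw [Ann_contract hu]
    exact Eq.to_iff (congrArg (· ∈ Ann F) (φ.apply_symm_apply s))
  refine ⟨π, Ideal.Quotient.mk_surjective.comp φ.symm.surjective, ?_⟩
  rw [hker]
  exact ⟨hF.isHomogeneousIdeal_Ann, hF.not_pow_le_Ann hF0, mem_PLE_iff_pow_le_Ann.1 hF.mem_PLE⟩

theorem isTwistedForm_of_isCanonicallyGraded [IsLocalRing (Apolar f)]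
    (hgr : IsCanonicallyGraded k (Apolar f)) (hd : HasSocleDegree (Apolar f) d) :
    IsTwistedForm d f := by
  let π := Ideal.Quotient.mkₐ k (Ann f)
  have hπ : Function.Surjective π := Ideal.Quotient.mk_surjective
  have hbot := (maximalIdeal_pow_eq_bot_iff hπ _).2 ((hasSocleDegree_iff hπ).1 hd).2
  obtain ⟨ρ, hρ, hhom⟩ := hgr.exists_isHomogeneousIdeal_ker hπ hbot
  obtain ⟨φ, hφ⟩ := exists_algEquiv_comp_eq hπ hρ hbot
  have hAnn : Ann (f ∘ₗ φ.symm.toLinearMap) = RingHom.ker ρ := by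
    ext s
    rw [mem_Ann_comp_algEquiv, RingHom.mem_ker, ← Ideal.Quotient.eq_zero_iff_mem]
    change π (φ.symm s) = 0 ↔ _
    rw [← hφ]
    change ρ (φ (φ.symm s)) = 0 ↔ _
    rw [φ.apply_symm_apply]
  have hsocle := (hasSocleDegree_iff hρ).1 hd
  rw [← hAnn] at hhom hsocle
  obtain ⟨u, F, hu, hF, hF0, huF⟩ :=
    exists_eq_contract_isForm (mem_PLE_iff_pow_le_Ann.2 hsocle.2) hsocle.1 hhom
  refine ⟨φ, u, F, hu, hF, hF0, ?_⟩
  rw [← huF]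
  exact LinearMap.ext fun s => (congrArg f (φ.symm_apply_apply s)).symm

theorem mem_canGradedLocus_iff {f : PLE k n d} :
    f ∈ canGradedLocus k n d ↔ IsTwistedForm d (f : Module.Dual k (S k n)) := by
  refine ⟨fun ⟨_, hgr, hd⟩ => isTwistedForm_of_isCanonicallyGraded hgr hd, fun h => ?_⟩
  obtain ⟨π, hπ, hhom, hsocle⟩ := h.exists_presentation
  have : Nontrivial (Apolar (f : Module.Dual k (S k n))) := by
    by_contra htriv
    rw [not_nontrivial_iff_subsingleton] at htriv
    exact hsocle.1 fun s _ => Subsingleton.elim _ _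
  have := IsLocalRing.of_surjective' (π : S k n →+* Apolar (f : Module.Dual k (S k n))) hπ
  exact ⟨this, isCanonicallyGraded_of_isHomogeneousIdeal_ker hπ
    ((maximalIdeal_pow_eq_bot_iff hπ _).2 hsocle.2) hhom, (hasSocleDegree_iff hπ).2 hsocle⟩

end TwistedForms

section AffineSpace

variable {k : Type*} [Field k] {V W : Type*} [AddCommGroup V] [Module k V] [AddCommGroup W]
  [Module k W]

variable (k V) in
/-- The coordinate ring of `V`, regarded as an affine space: the algebra of polynomial functions
on `V`, which is generated by the linear functionals. -/
def coordinateRing : Subalgebra k (V → k) :=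
  Algebra.adjoin k (Set.range fun (l : Module.Dual k V) v => l v)

theorem coe_dual_mem_coordinateRing (l : Module.Dual k V) : ⇑l ∈ coordinateRing k V :=
  Algebra.subset_adjoin ⟨l, rfl⟩

theorem mem_coordinateRing_iff {p : V → k} : p ∈ coordinateRing k V ↔
    ∃ P : MvPolynomial (Module.Dual k V) k, ∀ v, MvPolynomial.eval (fun l => l v) P = p v := by
  have h (P : MvPolynomial (Module.Dual k V) k) (v : V) :
      MvPolynomial.aeval (fun (l : Module.Dual k V) v => l v) P v =
        MvPolynomial.eval (fun l => l v) P := by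
    rw [← MvPolynomial.aeval_eq_eval]
    exact MvPolynomial.comp_aeval_apply (fun (l : Module.Dual k V) v => l v)
      (Pi.evalAlgHom k (fun _ : V => k) v) P
  rw [coordinateRing, Algebra.adjoin_range_eq_range_aeval]
  simp_rw [AlgHom.mem_range, funext_iff, h]

theorem det_mem_coordinateRing {ι : Type*} [Fintype ι] [DecidableEq ι] {M : V → Matrix ι ι k}
    (hM : ∀ i j, (fun v => M v i j) ∈ coordinateRing k V) :
    (fun v => (M v).det) ∈ coordinateRing k V := by
  have h : (fun v => (M v).det) = ∑ τ, Equiv.Perm.sign τ • ∏ i, fun v => M v (τ i) i := by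
    ext v
    simp [Matrix.det_apply]
  rw [h]
  exact sum_mem fun τ _ =>
    (coordinateRing k V).toSubring.zsmul_mem (prod_mem fun i _ => hM _ i) _

theorem exists_polynomial_eval_eq {p : V → k} (hp : p ∈ coordinateRing k V) (v w : V) :
    ∃ P : Polynomial k, ∀ t, P.eval t = p (v + t • w) := by
  induction hp using Algebra.adjoin_induction with
  | mem p hp =>
    obtain ⟨l, rfl⟩ := hp
    exact ⟨.C (l v) + .X * .C (l w), fun t => by simp [mul_comm t]⟩
  | algebraMap c => exact ⟨.C c, fun t => Polynomial.eval_C⟩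
  | add p q _ _ hp hq =>
    obtain ⟨⟨P, hP⟩, Q, hQ⟩ := And.intro hp hq
    exact ⟨P + Q, fun t => by rw [Polynomial.eval_add, hP, hQ, Pi.add_apply]⟩
  | mul p q _ _ hp hq =>
    obtain ⟨⟨P, hP⟩, Q, hQ⟩ := And.intro hp hq
    exact ⟨P * Q, fun t => by rw [Polynomial.eval_mul, hP, hQ, Pi.mul_apply]⟩

theorem finite_setOf_eq_zero [Infinite k] {p : V → k} (hp : p ∈ coordinateRing k V) {v w : V}
    {s : k} (hs : p (v + s • w) ≠ 0) : {t : k | p (v + t • w) = 0}.Finite := by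
  obtain ⟨P, hP⟩ := exists_polynomial_eval_eq hp v w
  have hP0 : P ≠ 0 := by
    rintro rfl
    exact hs (by rw [← hP, Polynomial.eval_zero])
  convert P.rootSet_finite k using 1
  ext t
  rw [Polynomial.mem_rootSet, Polynomial.coe_aeval_eq_eval, hP]
  exact (and_iff_right hP0).symm

instance [FiniteDimensional k V] : Algebra.FiniteType k (coordinateRing k V) := by
  let b := Module.finBasis k (Module.Dual k V)
  have h : coordinateRing k V = Algebra.adjoin k (Set.range fun i v => b i v) := by
    refine le_antisymm (Algebra.adjoin_le ?_) (Algebra.adjoin_mono ?_)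
    · rintro _ ⟨l, rfl⟩
      have hl : (fun v => l v) = ∑ i, b.repr l i • fun v => b i v := by
        ext v
        rw [← b.sum_repr l]
        simp [-Module.Basis.sum_repr]
      simp only [hl]
      exact Subalgebra.sum_mem _ fun i _ =>
        Subalgebra.smul_mem _ (Algebra.subset_adjoin (Set.mem_range_self i)) _
    · rintro _ ⟨i, rfl⟩
      exact Set.mem_range_self (b i)
  rw [h]
  exact .adjoin_of_finite (Set.finite_range _)

variable (k) in
/-- Evaluation of polynomial functions at a point of `V`. -/
def evalAt (v : V) : coordinateRing k V →ₐ[k] k :=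
  (Pi.evalAlgHom k (fun _ : V => k) v).comp (coordinateRing k V).val

theorem evalAt_injective : Function.Injective (evalAt k : V → coordinateRing k V →ₐ[k] k) := by
  intro v w h
  rw [← sub_eq_zero, ← Module.forall_dual_apply_eq_zero_iff k]
  intro l
  rw [map_sub, sub_eq_zero]
  exact DFunLike.congr_fun h ⟨l, coe_dual_mem_coordinateRing l⟩

theorem evalAt_surjective [FiniteDimensional k V] :
    Function.Surjective (evalAt k : V → coordinateRing k V →ₐ[k] k) := by
  intro χ
  let ι : Module.Dual k V →ₗ[k] coordinateRing k V :=
    { toFun := fun l => ⟨l, coe_dual_mem_coordinateRing l⟩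
      map_add' := fun _ _ => rfl
      map_smul' := fun _ _ => rfl }
  obtain ⟨v, hv⟩ := (Module.evalEquiv k V).surjective (χ.toLinearMap ∘ₗ ι)
  refine ⟨v, AlgHom.adjoin_ext ?_⟩
  rintro _ ⟨l, rfl⟩
  exact DFunLike.congr_fun hv l

theorem algHom_eq_of_ker_le {A : Type*} [Ring A] [Algebra k A] {χ ψ : A →ₐ[k] k}
    (h : RingHom.ker χ ≤ RingHom.ker ψ) : χ = ψ := by
  ext a
  have ha : a - algebraMap k A (χ a) ∈ RingHom.ker ψ :=
    h (by rw [RingHom.mem_ker, map_sub, AlgHom.commutes, Algebra.algebraMap_self_apply, sub_self])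
  rw [RingHom.mem_ker, map_sub, AlgHom.commutes, sub_eq_zero] at ha
  exact ha.symm

theorem exists_algHom_ker_eq [IsAlgClosed k] {A : Type*} [CommRing A] [Algebra k A]
    [Algebra.FiniteType k A] (m : Ideal A) [m.IsMaximal] :
    ∃ χ : A →ₐ[k] k, RingHom.ker χ = m := by
  let := Ideal.Quotient.field m
  have := finite_of_finite_type_of_isJacobsonRing k (A ⧸ m)
  let e := (AlgEquiv.ofBijective (Algebra.ofId k (A ⧸ m))
    IsAlgClosed.algebraMap_bijective_of_isIntegral).symm
  refine ⟨(e : A ⧸ m →ₐ[k] k).comp (Ideal.Quotient.mkₐ k m), ?_⟩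
  ext a
  rw [RingHom.mem_ker, AlgHom.comp_apply]
  exact (map_eq_zero_iff e e.injective).trans Ideal.Quotient.eq_zero_iff_mem

/-- A map between vector spaces is polynomial if its coordinates are polynomial functions. -/
def IsPolynomialMap (k : Type*) [Field k] [Module k V] [Module k W] (φ : W → V) : Prop :=
  ∀ l : Module.Dual k V, l ∘ φ ∈ coordinateRing k W

theorem IsPolynomialMap.comp_mem {φ : W → V} (hφ : IsPolynomialMap k φ) {p : V → k}
    (hp : p ∈ coordinateRing k V) : p ∘ φ ∈ coordinateRing k W := by
  induction hp using Algebra.adjoin_induction with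
  | mem p hp =>
    obtain ⟨l, rfl⟩ := hp
    exact hφ l
  | algebraMap c => exact algebraMap_mem (coordinateRing k W) c
  | add p q _ _ hp hq => exact add_mem hp hq
  | mul p q _ _ hp hq => exact mul_mem hp hq

/-- Pullback of polynomial functions along a polynomial map. -/
def IsPolynomialMap.pullback {φ : W → V} (hφ : IsPolynomialMap k φ) :
    coordinateRing k V →ₐ[k] coordinateRing k W where
  toFun p := ⟨p.1 ∘ φ, hφ.comp_mem p.2⟩
  map_one' := rfl
  map_mul' _ _ := rfl
  map_zero' := rfl
  map_add' _ _ := rfl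
  commutes' _ := rfl

theorem isPolynomialMap_sum_smul {ι : Type*} [Fintype ι] {p : ι → W → k}
    (hp : ∀ i, p i ∈ coordinateRing k W) (v : ι → V) :
    IsPolynomialMap k fun w => ∑ i, p i w • v i := fun l => by
  have h : (l ∘ fun w => ∑ i, p i w • v i) = ∑ i, l (v i) • p i := by
    ext w
    simp [mul_comm]
  rw [h]
  exact Subalgebra.sum_mem _ fun i _ => Subalgebra.smul_mem _ (hp i) _

variable (k) in
/-- The closed point of the spectrum of the coordinate ring corresponding to a point of `V`. -/
def toPrimeSpectrum (v : V) : PrimeSpectrum (coordinateRing k V) :=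
  ⟨RingHom.ker (evalAt k v), RingHom.ker_isPrime _⟩

theorem exists_toPrimeSpectrum_mem [IsAlgClosed k] [FiniteDimensional k V]
    {U : Set (PrimeSpectrum (coordinateRing k V))} (hU : IsOpen U)
    {x : PrimeSpectrum (coordinateRing k V)} (hx : x ∈ U) :
    ∃ v : V, toPrimeSpectrum k v ∈ U ∧ x ≤ toPrimeSpectrum k v := by
  have : IsJacobsonRing (coordinateRing k V) := isJacobsonRing_of_finiteType (A := k)
  obtain ⟨y, ⟨hxy, hyU⟩, hy⟩ := nonempty_inter_closedPoints
    (Z := closure {x} ∩ U) ⟨x, subset_closure (Set.mem_singleton x), hx⟩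
    (isClosed_closure.isLocallyClosed.inter hU.isLocallyClosed)
  have hmax : y.asIdeal.IsMaximal := (PrimeSpectrum.isClosed_singleton_iff_isMaximal y).1 hy
  obtain ⟨χ, hχ⟩ := exists_algHom_ker_eq (k := k) y.asIdeal
  obtain ⟨v, rfl⟩ := evalAt_surjective χ
  obtain rfl : toPrimeSpectrum k v = y := PrimeSpectrum.ext hχ
  exact ⟨v, hyU, (PrimeSpectrum.le_iff_mem_closure _ _).2 hxy⟩

theorem image_eq_preimage_comap_pullback [IsAlgClosed k] [FiniteDimensional k W] {φ : W → V}
    (hφ : IsPolynomialMap k φ) {U : Set (PrimeSpectrum (coordinateRing k W))} (hU : IsOpen U) :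
    φ '' (toPrimeSpectrum k ⁻¹' U) =
      toPrimeSpectrum k ⁻¹' (PrimeSpectrum.comap (hφ.pullback : _ →+* _) '' U) := by
  ext v
  constructor
  · rintro ⟨w, hw, rfl⟩
    exact ⟨toPrimeSpectrum k w, hw, rfl⟩
  · rintro ⟨x, hx, hxv⟩
    obtain ⟨w, hw, hxw⟩ := exists_toPrimeSpectrum_mem hU hx
    refine ⟨w, hw, (evalAt_injective (algHom_eq_of_ker_le (k := k) ?_)).symm⟩
    exact (congrArg PrimeSpectrum.asIdeal hxv).ge.trans (Ideal.comap_mono hxw)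

end AffineSpace

section ZariskiTopology

variable {k : Type*} [Field k] {V W : Type*} [AddCommGroup V] [Module k V] [AddCommGroup W]
  [Module k W] [TopologicalSpace V] [TopologicalSpace W]

/-- The topology of `V` is the Zariski topology. -/
class IsZariski (k V : Type*) [Field k] [AddCommGroup V] [Module k V] [t : TopologicalSpace V] :
    Prop where
  eq_zariskiTopology : t = zariskiTopology k V

instance (n d : ℕ) : IsZariski k (PLE k n d) := ⟨rfl⟩

variable [IsZariski k V] [IsZariski k W]

theorem isTopologicalBasis_setOf_ne_zero : TopologicalSpace.IsTopologicalBasis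
    {U : Set V | ∃ p ∈ coordinateRing k V, U = {v | p v ≠ 0}} := by
  refine TopologicalSpace.isTopologicalBasis_of_subbasis_of_finiteInter ?_
    ⟨⟨1, one_mem _, ?_⟩, ?_⟩
  · rw [IsZariski.eq_zariskiTopology (k := k) (V := V), zariskiTopology]
    congr 1
    ext U
    refine ⟨fun ⟨P, hP⟩ => ⟨_, mem_coordinateRing_iff.2 ⟨P, fun v => rfl⟩, hP⟩, ?_⟩
    rintro ⟨p, hp, rfl⟩
    obtain ⟨P, hP⟩ := mem_coordinateRing_iff.1 hp
    exact ⟨P, by simp_rw [hP]⟩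
  · exact (Set.eq_univ_of_forall fun v => one_ne_zero).symm
  · rintro _ ⟨p, hp, rfl⟩ _ ⟨q, hq, rfl⟩
    exact ⟨p * q, mul_mem hp hq, Set.ext fun v => mul_ne_zero_iff.symm⟩

theorem isOpen_setOf_ne_zero {p : V → k} (hp : p ∈ coordinateRing k V) :
    IsOpen {v | p v ≠ 0} :=
  isTopologicalBasis_setOf_ne_zero.isOpen ⟨p, hp, rfl⟩

theorem exists_ne_zero_of_isOpen {U : Set V} (hU : IsOpen U) {v : V} (hv : v ∈ U) :
    ∃ p ∈ coordinateRing k V, p v ≠ 0 ∧ {w | p w ≠ 0} ⊆ U := by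
  obtain ⟨_, ⟨p, hp, rfl⟩, hpv, hpU⟩ :=
    (isTopologicalBasis_setOf_ne_zero (k := k)).exists_subset_of_mem_open hv hU
  exact ⟨p, hp, hpv, hpU⟩

theorem IsPolynomialMap.continuous {φ : W → V} (hφ : IsPolynomialMap k φ) : Continuous φ := by
  refine (isTopologicalBasis_setOf_ne_zero (k := k)).continuous_iff.2 ?_
  rintro _ ⟨p, hp, rfl⟩
  exact isOpen_setOf_ne_zero (hφ.comp_mem hp)

theorem mem_closure_of_forall_add_smul_mem [Infinite k] {s : Set V} {v w : V}
    (h : ∀ t : k, t ≠ 0 → v + t • w ∈ s) : v ∈ closure s := by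
  refine mem_closure_iff.2 fun U hU hv => ?_
  obtain ⟨p, hp, hpv, hpU⟩ := exists_ne_zero_of_isOpen (k := k) hU hv
  have hfin := finite_setOf_eq_zero hp (v := v) (w := w) (s := 0) (by simpa using hpv)
  obtain ⟨t, ht⟩ := (hfin.insert 0).exists_notMem
  rw [Set.mem_insert_iff, not_or] at ht
  exact ⟨v + t • w, hpU ht.2, h t ht.1⟩

variable (k V) in
theorem isPreirreducible_univ_of_isZariski [Infinite k] :
    IsPreirreducible (Set.univ : Set V) := by
  rintro U U' hU hU' ⟨v, -, hv⟩ ⟨w, -, hw⟩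
  obtain ⟨p, hp, hpv, hpU⟩ := exists_ne_zero_of_isOpen (k := k) hU hv
  obtain ⟨q, hq, hqw, hqU⟩ := exists_ne_zero_of_isOpen (k := k) hU' hw
  -- On the line through `v` and `w` both functions vanish only finitely often.
  have hpfin := finite_setOf_eq_zero hp (v := v) (w := w - v) (s := 0) (by simpa using hpv)
  have hqfin := finite_setOf_eq_zero hq (v := v) (w := w - v) (s := 1) (by simpa using hqw)
  obtain ⟨t, ht⟩ := (hpfin.union hqfin).exists_notMem
  rw [Set.mem_union, not_or] at ht
  exact ⟨v + t • (w - v), trivial, hpU ht.1, hqU ht.2⟩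

theorem isPreirreducible_image [Infinite k] {φ : W → V} (hφ : IsPolynomialMap k φ) {U : Set W}
    (hU : IsOpen U) : IsPreirreducible (φ '' U) :=
  ((isPreirreducible_univ_of_isZariski k W).open_subset hU U.subset_univ).image φ
    hφ.continuous.continuousOn

theorem isInducing_toPrimeSpectrum :
    Topology.IsInducing (toPrimeSpectrum k : V → PrimeSpectrum (coordinateRing k V)) := by
  refine ⟨(isTopologicalBasis_setOf_ne_zero (k := k)).eq_generateFrom.trans (Eq.trans ?_
    (TopologicalSpace.IsTopologicalBasis.eq_generateFrom (t := .induced _ _)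
      (PrimeSpectrum.isTopologicalBasis_basic_opens.induced _)).symm)⟩
  congr 1
  ext U
  constructor
  · rintro ⟨p, hp, rfl⟩
    exact ⟨_, ⟨⟨p, hp⟩, rfl⟩, rfl⟩
  · rintro ⟨_, ⟨p, rfl⟩, rfl⟩
    exact ⟨p.1, p.2, rfl⟩

variable (k V) in
theorem noetherianSpace_of_isZariski [FiniteDimensional k V] :
    TopologicalSpace.NoetherianSpace V :=
  have : IsNoetherianRing (coordinateRing k V) := Algebra.FiniteType.isNoetherianRing k _
  isInducing_toPrimeSpectrum (k := k).noetherianSpace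

theorem isConstructible_image [IsAlgClosed k] [FiniteDimensional k V] [FiniteDimensional k W]
    {φ : W → V} (hφ : IsPolynomialMap k φ) {U : Set W} (hU : IsOpen U) :
    Topology.IsConstructible (φ '' U) := by
  have := noetherianSpace_of_isZariski k V
  have : IsNoetherianRing (coordinateRing k V) := Algebra.FiniteType.isNoetherianRing k _
  have : IsNoetherianRing (coordinateRing k W) := Algebra.FiniteType.isNoetherianRing k _
  obtain ⟨U, hU', rfl⟩ := (isInducing_toPrimeSpectrum (k := k)).isOpen_iff.1 hU
  have hfin : (hφ.pullback : coordinateRing k V →+* coordinateRing k W).FinitePresentation :=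
    RingHom.FinitePresentation.of_finiteType.1
      (.of_comp_finiteType (f := algebraMap k _) (RingHom.finiteType_algebraMap.2 inferInstance))
  have hUc : Topology.IsConstructible U :=
    IsRetrocompact.isConstructible hU'
      fun _ _ _ => TopologicalSpace.NoetherianSpace.isCompact _
  rw [image_eq_preimage_comap_pullback hφ hU']
  exact (PrimeSpectrum.isConstructible_comap_image hfin hUc).preimage
    isInducing_toPrimeSpectrum.continuous
    fun _ _ _ _ _ _ => TopologicalSpace.NoetherianSpace.isCompact _

end ZariskiTopology

section Parametrization

variable {k : Type*} [Field k] {n d : ℕ}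

/-- The power series of degree at most `e` with prescribed coefficients. -/
def ofCoeffs (k : Type*) [Field k] (n e : ℕ) : (Exponent n e → k) →ₗ[k] S k n :=
  ∑ a : Exponent n e, monomial a.1 ∘ₗ LinearMap.proj a

theorem sub_ofCoeffs_mem (e : ℕ) (s : S k n) :
    s - ofCoeffs k n e (fun a => coeff a.1 s) ∈ maximalIdeal (S k n) ^ (e + 1) := by
  simpa [ofCoeffs] using sub_sum_monomial_mem e s

/-- The affine space parametrizing the data `(φ, u, F)` of a twisted form of degree `d`, up to
terms which do not change the functional: the coefficients of `u`, those of the images under `φ` of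
the variables, and a functional whose component of degree `d` is `F`. The series are truncated in
degree `d + 1` rather than `d`, so that the linear part of `φ` survives even for `d = 0`. -/
def Parameter (k : Type*) [Field k] (n d : ℕ) : Type _ :=
  (Exponent n (d + 1) → k) × (Fin n → Exponent n (d + 1) → k) × PLE k n d

namespace Parameter

instance : AddCommGroup (Parameter k n d) :=
  inferInstanceAs (AddCommGroup ((_ → k) × (Fin n → _ → k) × PLE k n d))

instance : Module k (Parameter k n d) :=
  inferInstanceAs (Module k ((_ → k) × (Fin n → _ → k) × PLE k n d))

instance : TopologicalSpace (Parameter k n d) := zariskiTopology k (Parameter k n d)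

instance : IsZariski k (Parameter k n d) := ⟨rfl⟩

/-- The identification of the parameters with the triples which they are by definition. -/
def toProd : Parameter k n d ≃ₗ[k]
    (Exponent n (d + 1) → k) × (Fin n → Exponent n (d + 1) → k) × PLE k n d :=
  .refl k _

instance : FiniteDimensional k (Parameter k n d) :=
  Module.Finite.equiv toProd.symm

/-- The truncation of the factor `u`. -/
def unit : Parameter k n d →ₗ[k] S k n :=
  ofCoeffs k n (d + 1) ∘ₗ LinearMap.fst k _ _ ∘ₗ toProd.toLinearMap

/-- The truncation of the image of the variable `X i`. Its constant term is discarded. -/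
def coord (i : Fin n) : Parameter k n d →ₗ[k] S k n :=
  (LinearMap.id - homogeneousComponent 0) ∘ₗ ofCoeffs k n (d + 1) ∘ₗ LinearMap.proj i ∘ₗ
    LinearMap.fst k _ _ ∘ₗ LinearMap.snd k _ _ ∘ₗ toProd.toLinearMap

/-- The form `F`. -/
def form : Parameter k n d →ₗ[k] Module.Dual k (S k n) :=
  (homogeneousComponent d).dualMap ∘ₗ (PLE k n d).subtype ∘ₗ LinearMap.snd k _ _ ∘ₗ
    LinearMap.snd k _ _ ∘ₗ toProd.toLinearMap

theorem isForm_form (y : Parameter k n d) : IsForm d y.form := fun s =>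
  congrArg (toProd y).2.2.1 ((homogeneousComponent_homogeneousComponent d d s).trans (if_pos rfl))

theorem constantCoeff_coord (y : Parameter k n d) (i : Fin n) :
    constantCoeff (coord i y) = 0 := by
  rw [← coeff_zero_eq_constantCoeff_apply, coord, LinearMap.comp_apply, LinearMap.sub_apply,
    map_sub, coeff_homogeneousComponent, if_pos (map_zero _), LinearMap.id_apply, sub_self]

theorem exists_of_isForm (u : S k n) {b : Fin n → S k n} (hb : ∀ i, constantCoeff (b i) = 0)
    {F : Module.Dual k (S k n)} (hF : IsForm d F) : ∃ y : Parameter k n d,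
      u - y.unit ∈ maximalIdeal (S k n) ^ (d + 2) ∧
      (∀ i, b i - coord i y ∈ maximalIdeal (S k n) ^ (d + 2)) ∧ y.form = F := by
  refine ⟨toProd.symm (fun a => coeff a.1 u, fun i a => coeff a.1 (b i), ⟨F, hF.mem_PLE⟩),
    sub_ofCoeffs_mem _ u, fun i => ?_, LinearMap.ext hF⟩
  have hmem := sub_ofCoeffs_mem (d + 1) (b i)
  have hconst : homogeneousComponent 0 (b i) = 0 :=
    homogeneousComponent_eq_zero_of_mem zero_lt_one
      ((pow_one (maximalIdeal (S k n))).symm ▸ mem_maximalIdeal_iff.2 (hb i))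
  have hzero := homogeneousComponent_eq_zero_of_mem (d + 1).succ_pos hmem
  rw [map_sub, hconst, zero_sub, neg_eq_zero] at hzero
  change b i - (ofCoeffs k n (d + 1) (fun a => coeff a.1 (b i)) -
    homogeneousComponent 0 (ofCoeffs k n (d + 1) fun a => coeff a.1 (b i))) ∈ _
  rwa [hzero, sub_zero]

/-- The parameters for which `u` is a unit, `φ` is an automorphism and `F ≠ 0`. -/
def nondegenerate (k : Type*) [Field k] (n d : ℕ) : Set (Parameter k n d) :=
  {y | constantCoeff y.unit ≠ 0 ∧ (jacobian fun i => coord i y).det ≠ 0 ∧ y.form ≠ 0}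

theorem isOpen_nondegenerate : IsOpen (nondegenerate k n d) := by
  refine (isOpen_setOf_ne_zero (k := k) ?_).inter
    ((isOpen_setOf_ne_zero (k := k) ?_).inter ?_)
  · exact coe_dual_mem_coordinateRing (coeff 0 ∘ₗ unit)
  · exact det_mem_coordinateRing fun i j =>
      coe_dual_mem_coordinateRing (coeff (Finsupp.single j 1) ∘ₗ coord i)
  · have h : {y : Parameter k n d | y.form ≠ 0} = ⋃ s, {y | y.form s ≠ 0} := by
      ext y
      simp [DFunLike.ext_iff]
    change IsOpen {y : Parameter k n d | y.form ≠ 0}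
    rw [h]
    exact isOpen_iUnion fun s => isOpen_setOf_ne_zero (k := k) <|
      coe_dual_mem_coordinateRing (LinearMap.applyₗ s ∘ₗ form)

end Parameter

/-- The families of power series which depend polynomially on a point of `W`. -/
def polynomialFamilies (k W : Type*) [Field k] [AddCommGroup W] [Module k W] (n : ℕ) :
    Submonoid (W → S k n) where
  carrier := {s | ∀ a, (fun w => coeff a (s w)) ∈ coordinateRing k W}
  one_mem' a := by
    exact algebraMap_mem (coordinateRing k W) (coeff a (1 : S k n))
  mul_mem' {s t} hs ht a := by
    classical
    have h : (fun w => coeff a ((s * t) w)) =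
        ∑ p ∈ antidiagonal a, (fun w => coeff p.1 (s w)) * fun w => coeff p.2 (t w) := by
      ext w
      simp [coeff_mul]
    exact h ▸ sum_mem fun p _ => mul_mem (hs p.1) (ht p.2)

theorem coe_mem_polynomialFamilies {W : Type*} [AddCommGroup W] [Module k W] (l : W →ₗ[k] S k n) :
    ⇑l ∈ polynomialFamilies k W n :=
  fun a => coe_dual_mem_coordinateRing (coeff a ∘ₗ l)

theorem contract_comp_algEquiv_eq_sum {φ : S k n ≃ₐ[k] S k n} {u v : S k n} {b : Fin n → S k n}
    {F : Module.Dual k (S k n)} (hF : F ∈ PLE k n d)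
    (hv : u - v ∈ maximalIdeal (S k n) ^ (d + 1))
    (hb : ∀ i, φ (X i) - b i ∈ maximalIdeal (S k n) ^ (d + 1)) :
    contract u F ∘ₗ φ.toLinearMap =
      ∑ a : Exponent n d, F (v * ∏ i, b i ^ a.1 i) • dpMonomial k n a.1 := by
  rw [mem_PLE_iff] at hF
  have hφ (s : S k n) (hs : s ∈ maximalIdeal (S k n) ^ (d + 1)) :
      (contract u F ∘ₗ φ.toLinearMap) s = 0 :=
    hF _ (Ideal.mul_mem_right _ _
      (map_mem_maximalIdeal_pow (π := (φ : S k n →ₐ[k] S k n)) φ.surjective hs))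
  rw [eq_sum_dpMonomial hφ]
  refine Finset.sum_congr rfl fun a _ => congrArg (· • _) ?_
  change F (φ (monomial a.1 1) * u) = _
  rw [← sub_eq_zero, ← map_sub]
  have hmon : φ (monomial a.1 1) = ∏ i, φ (X i) ^ a.1 i := by
    rw [monomial_eq', map_one, one_mul, Finsupp.prod_fintype _ _ fun _ => pow_zero _, map_prod]
    simp_rw [map_pow]
  refine hF _ (Ideal.Quotient.eq.1 ?_)
  rw [hmon, mul_comm]
  simp_rw [map_mul, map_prod, map_pow, Ideal.Quotient.eq.2 (hb _), Ideal.Quotient.eq.2 hv]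

/-- The twisted form with the given parameters. -/
def ofParameter (y : Parameter k n d) : PLE k n d :=
  ∑ a : Exponent n d, y.form (y.unit * ∏ i, Parameter.coord i y ^ a.1 i) •
    ⟨dpMonomial k n a.1, Submodule.subset_span ⟨a.1, a.2, rfl⟩⟩

theorem ofParameter_eq {y : Parameter k n d} {φ : S k n ≃ₐ[k] S k n} {u : S k n}
    (hu : u - y.unit ∈ maximalIdeal (S k n) ^ (d + 1))
    (hφ : ∀ i, φ (X i) - Parameter.coord i y ∈ maximalIdeal (S k n) ^ (d + 1)) :
    (ofParameter y : Module.Dual k (S k n)) = contract u y.form ∘ₗ φ.toLinearMap := by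
  rw [contract_comp_algEquiv_eq_sum y.isForm_form.mem_PLE hu hφ]
  simp [ofParameter]

theorem isPolynomialMap_ofParameter :
    IsPolynomialMap k (ofParameter : Parameter k n d → PLE k n d) := by
  refine isPolynomialMap_sum_smul (fun a => ?_) _
  have hs : (fun y : Parameter k n d => y.unit * ∏ i, Parameter.coord i y ^ a.1 i) ∈
      polynomialFamilies k (Parameter k n d) n := by
    have h := mul_mem (coe_mem_polynomialFamilies (Parameter.unit (k := k) (n := n) (d := d)))
      (prod_mem fun i (_ : i ∈ Finset.univ) =>
        pow_mem (coe_mem_polynomialFamilies (Parameter.coord (k := k) (d := d) i)) (a.1 i))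
    convert h using 1
    ext1 y
    simp
  have hsum : (fun y : Parameter k n d => y.form (y.unit * ∏ i, Parameter.coord i y ^ a.1 i)) =
      ∑ c : Exponent n d, (fun y => y.form (monomial c.1 1)) *
        fun y => coeff c.1 (y.unit * ∏ i, Parameter.coord i y ^ a.1 i) := by
    ext y
    conv_lhs => rw [eq_sum_dpMonomial (mem_PLE_iff.1 y.isForm_form.mem_PLE)]
    simp [dpMonomial]
  rw [hsum]
  refine sum_mem fun c _ => mul_mem ?_ (hs c.1)
  exact coe_dual_mem_coordinateRing (LinearMap.applyₗ _ ∘ₗ Parameter.form)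

theorem image_ofParameter_nondegenerate :
    ofParameter '' Parameter.nondegenerate k n d = canGradedLocus k n d := by
  ext f
  rw [mem_canGradedLocus_iff]
  constructor
  · rintro ⟨y, ⟨hu, hdet, hF⟩, rfl⟩
    obtain ⟨φ, hφ⟩ := exists_algEquiv_X_iff.2 ⟨y.constantCoeff_coord, hdet⟩
    refine ⟨φ, y.unit, y.form, isUnit_iff_constantCoeff.2 hu.isUnit, y.isForm_form, hF, ?_⟩
    exact ofParameter_eq (by simp) (by simp [hφ])
  · rintro ⟨φ, u, F, hu, hF, hF0, hf⟩
    obtain ⟨hconst, hdet⟩ := exists_algEquiv_X_iff.1 ⟨φ, fun i => rfl⟩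
    obtain ⟨y, hyu, hyφ, rfl⟩ := Parameter.exists_of_isForm u hconst hF
    have hle := Ideal.pow_le_pow_right (I := maximalIdeal (S k n)) (d + 1).le_succ
    refine ⟨y, ⟨?_, ?_, hF0⟩,
      Subtype.ext ((ofParameter_eq (hle hyu) fun i => hle (hyφ i)).trans hf.symm)⟩
    · have h := coeff_eq_zero_of_mem_maximalIdeal_pow hyu (a := 0) (by simp)
      rw [map_sub, sub_eq_zero] at h
      exact h ▸ (isUnit_iff_constantCoeff.1 hu).ne_zero
    · have h : (jacobian fun i => Parameter.coord i y) = jacobian fun i => φ (X i) := by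
        ext i j
        have h := coeff_eq_zero_of_mem_maximalIdeal_pow (hyφ i) (a := Finsupp.single j 1)
          (by simp)
        rw [map_sub, sub_eq_zero] at h
        exact h.symm
      rwa [h]

theorem isPreirreducible_canGradedLocus [Infinite k] :
    IsPreirreducible (canGradedLocus k n d) :=
  image_ofParameter_nondegenerate (k := k) ▸
    isPreirreducible_image isPolynomialMap_ofParameter Parameter.isOpen_nondegenerate

theorem isConstructible_canGradedLocus [IsAlgClosed k] :
    Topology.IsConstructible (canGradedLocus k n d) :=
  image_ofParameter_nondegenerate (k := k) ▸
    isConstructible_image isPolynomialMap_ofParameter Parameter.isOpen_nondegenerate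

end Parametrization

section Examples

variable {k : Type*} [Field k] {n d e : ℕ} {i j : Fin n}

theorem IsForm.isTwistedForm_contract {F : Module.Dual k (S k n)} (hF : IsForm d F) (hF0 : F ≠ 0)
    {u : S k n} (hu : IsUnit u) : IsTwistedForm d (contract u F) :=
  ⟨.refl, u, F, hu, hF, hF0, rfl⟩

theorem contract_one_add_smul (c : k) (s : S k n) (f : Module.Dual k (S k n)) :
    contract (1 + c • s) f = f + c • contract s f := by
  ext t
  simp [contract, mul_add]

theorem IsForm.apply_pow_mul_eq_zero {F : Module.Dual k (S k n)} (hF : IsForm d F) {b : S k n}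
    (hb : b ∈ maximalIdeal (S k n)) (hFb : ∀ s ∈ maximalIdeal (S k n) ^ (d - 1), F (b * s) = 0)
    {m : ℕ} (hm : d + 1 ≤ 2 * m) (s : S k n) : F (b ^ m * s) = 0 := by
  have hF' := mem_PLE_iff.1 hF.mem_PLE
  -- By homogeneity `F` kills all multiples of the linear part `q` of `b`, and `b ^ m` is congruent
  -- modulo `q` to `(b - q) ^ m`, whose order exceeds `d`.
  let q := homogeneousComponent 1 b
  have hbq : b - q ∈ maximalIdeal (S k n) ^ 2 :=
    sub_homogeneousComponent_mem ((pow_one (maximalIdeal (S k n))).symm ▸ hb)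
  have hq_pow (t : S k n) (ht : t ∈ maximalIdeal (S k n) ^ (d - 1)) : F (q * t) = 0 := by
    have h : F ((b - q) * t) = 0 := by
      refine hF' _ (Ideal.pow_le_pow_right (by omega : d + 1 ≤ 2 + (d - 1)) ?_)
      rw [pow_add]
      exact Ideal.mul_mem_mul hbq ht
    rwa [sub_mul, map_sub, hFb t ht, zero_sub, neg_eq_zero] at h
  have hq (t : S k n) : F (q * t) = 0 := by
    rw [← hF, homogeneousComponent_homogeneousComponent_mul]
    split_ifs
    · exact hq_pow _ (homogeneousComponent_mem _ _)
    · exact map_zero F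
  obtain ⟨c, hc⟩ : q ∣ b ^ m - (b - q) ^ m := by
    simpa only [sub_sub_cancel] using sub_dvd_pow_sub_pow b (b - q) m
  have hpow : (b - q) ^ m ∈ maximalIdeal (S k n) ^ (d + 1) := by
    refine Ideal.pow_le_pow_right hm ?_
    rw [pow_mul]
    exact Ideal.pow_mem_pow hbq m
  rw [sub_eq_iff_eq_add.1 hc, add_mul, map_add, mul_assoc, hq,
    hF' _ (Ideal.mul_mem_right _ _ hpow), add_zero]

theorem IsTwistedForm.apply_pow_eq_zero {f : Module.Dual k (S k n)} (hf : IsTwistedForm d f)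
    {l : S k n} (hl : l ∈ maximalIdeal (S k n))
    (hfl : ∀ s ∈ maximalIdeal (S k n) ^ (d - 1), f (l * s) = 0) {m : ℕ} (hm : d + 1 ≤ 2 * m) :
    f (l ^ m) = 0 := by
  obtain ⟨φ, u, F, hu, hF, -, rfl⟩ := hf
  have hmem {r : ℕ} {s : S k n} (ψ : S k n ≃ₐ[k] S k n) (hs : s ∈ maximalIdeal (S k n) ^ r) :
      ψ s ∈ maximalIdeal (S k n) ^ r :=
    map_mem_maximalIdeal_pow (π := (ψ : S k n →ₐ[k] S k n)) ψ.surjective hs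
  have hφl : φ l ∈ maximalIdeal (S k n) := by simpa using hmem (r := 1) φ (by simpa using hl)
  change F (φ (l ^ m) * u) = 0
  rw [map_pow]
  refine hF.apply_pow_mul_eq_zero hφl (fun s hs => ?_) hm u
  have h : F (φ (l * φ.symm (s * ↑hu.unit⁻¹)) * u) = 0 :=
    hfl _ (hmem φ.symm (Ideal.mul_mem_right _ _ hs))
  rwa [map_mul φ, φ.apply_symm_apply, mul_assoc, mul_assoc, hu.val_inv_mul, mul_one] at h

/-- The divided power `x_i^[d]` of a variable. -/
def dpPower (k : Type*) [Field k] {n : ℕ} (i : Fin n) (d : ℕ) : Module.Dual k (S k n) :=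
  dpMonomial k n (Finsupp.single i d)

theorem dpPower_mem_PLE (i : Fin n) (hed : e ≤ d) : dpPower k i e ∈ PLE k n d :=
  Submodule.subset_span ⟨_, (Finsupp.degree_single i e).trans_le hed, rfl⟩

theorem isForm_dpPower (i : Fin n) (d : ℕ) : IsForm d (dpPower k i d) := fun _ =>
  (coeff_homogeneousComponent _ _ _).trans (if_pos (Finsupp.degree_single i d))

theorem dpPower_apply_X_pow_self (i : Fin n) (d : ℕ) : dpPower k i d (X i ^ d) = 1 := by
  classical
  exact (coeff_X_pow ..).trans (if_pos rfl)

theorem dpPower_apply_X_pow_of_ne (hij : i ≠ j) (hd : d ≠ 0) (e : ℕ) :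
    dpPower k j e (X i ^ d) = 0 := by
  classical
  refine (coeff_X_pow ..).trans (if_neg fun h => ?_)
  rw [Finsupp.single_eq_single_iff] at h
  omega

theorem contract_X_dpPower_succ (j : Fin n) (e : ℕ) :
    contract (X j) (dpPower k j (e + 1)) = dpPower k j e := by
  ext s
  have h := coeff_add_mul_monomial (Finsupp.single j e) (Finsupp.single j 1) s (1 : k)
  rwa [mul_one, ← Finsupp.single_add] at h

theorem contract_X_dpPower_of_ne (hij : i ≠ j) (d : ℕ) :
    contract (X j) (dpPower k i d) = 0 := by
  classical
  ext s
  refine (coeff_mul_monomial ..).trans (if_neg fun h => ?_)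
  have := h j
  simp [hij.symm] at this

theorem dpPower_add_smul_apply_X_pow (hij : i ≠ j) (hd : d ≠ 0) (t : k) :
    (dpPower k i d + t • dpPower k j e) (X i ^ d) = 1 := by
  rw [LinearMap.add_apply, LinearMap.smul_apply, dpPower_apply_X_pow_self,
    dpPower_apply_X_pow_of_ne hij hd, smul_zero, add_zero]

theorem dpPower_add_smul_notMem_PLE (hij : i ≠ j) (t : k) :
    dpPower k i (d + 1) + t • dpPower k j e ∉ PLE k n d := fun h =>
  one_ne_zero <| (dpPower_add_smul_apply_X_pow hij d.succ_ne_zero t).symm.trans <|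
    mem_PLE_iff.1 h _ (Ideal.pow_mem_pow (X_mem_maximalIdeal i) _)

theorem isTwistedForm_dpPower (i : Fin n) (d : ℕ) : IsTwistedForm d (dpPower k i d) := by
  have h := (isForm_dpPower (k := k) i d).isTwistedForm_contract
    (fun h => one_ne_zero ((dpPower_apply_X_pow_self i d).symm.trans (LinearMap.congr_fun h _)))
    isUnit_one
  rwa [contract_one] at h

theorem isTwistedForm_dpPower_add_add_smul (hij : i ≠ j) (e : ℕ) {s : k} (hs : s ≠ 0) :
    IsTwistedForm (e + 1) (dpPower k i (e + 1) + dpPower k j e + s • dpPower k j (e + 1)) := by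
  have hF : IsForm (e + 1) (dpPower k i (e + 1) + s • dpPower k j (e + 1)) := fun t => by
    simp_rw [LinearMap.add_apply, LinearMap.smul_apply, isForm_dpPower _ _ t]
  have hF0 : dpPower k i (e + 1) + s • dpPower k j (e + 1) ≠ 0 := fun h => one_ne_zero <|
    (dpPower_add_smul_apply_X_pow hij e.succ_ne_zero s).symm.trans (LinearMap.congr_fun h _)
  have hu : IsUnit (1 + s⁻¹ • X j : S k n) :=
    isUnit_iff_constantCoeff.2 (by simp)
  have hcontract : contract (X j) (dpPower k i (e + 1) + s • dpPower k j (e + 1)) =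
      s • dpPower k j e := by
    change contract (X j) (dpPower k i (e + 1)) + s • contract (X j) (dpPower k j (e + 1)) = _
    rw [contract_X_dpPower_of_ne hij, contract_X_dpPower_succ, zero_add]
  have h := hF.isTwistedForm_contract hF0 hu
  rwa [contract_one_add_smul, hcontract, inv_smul_smul₀ hs, add_right_comm] at h

theorem not_isTwistedForm_dpPower_add_smul (hij : i ≠ j) (he : 2 ≤ e) {t : k} (ht : t ≠ 0) :
    ¬ IsTwistedForm (e + 1) (dpPower k i (e + 1) + t • dpPower k j e) := by
  intro h
  obtain ⟨e, rfl⟩ := Nat.exists_eq_add_of_le' he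
  have hX (s : S k n) (hs : s ∈ maximalIdeal (S k n) ^ (e + 2)) :
      (dpPower k i (e + 3) + t • dpPower k j (e + 2)) (X j * s) = 0 := by
    have hi := LinearMap.congr_fun (contract_X_dpPower_of_ne (k := k) hij (e + 3)) s
    have hj := LinearMap.congr_fun (contract_X_dpPower_succ (k := k) j (e + 1)) s
    change dpPower k i (e + 3) (s * X j) = 0 at hi
    change dpPower k j (e + 2) (s * X j) = _ at hj
    rw [mul_comm, LinearMap.add_apply, LinearMap.smul_apply, hi, hj,
      mem_PLE_iff.1 (dpPower_mem_PLE j le_rfl) s hs, smul_zero, zero_add]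
  have hpow := h.apply_pow_eq_zero (X_mem_maximalIdeal j) hX
    (by omega : e + 2 + 1 + 1 ≤ 2 * (e + 2))
  rw [LinearMap.add_apply, LinearMap.smul_apply, dpPower_apply_X_pow_self,
    dpPower_apply_X_pow_of_ne hij.symm (by omega), zero_add, smul_eq_mul, mul_one] at hpow
  exact ht hpow

theorem isIrreducible_canGradedLocus [Infinite k] (i : Fin n) :
    IsIrreducible (canGradedLocus k n d) :=
  ⟨⟨⟨dpPower k i d, dpPower_mem_PLE i le_rfl⟩,
    mem_canGradedLocus_iff.2 (isTwistedForm_dpPower i d)⟩, isPreirreducible_canGradedLocus⟩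

theorem not_isOpen_canGradedLocus [Infinite k] (hij : i ≠ j) (he : 2 ≤ e) :
    ¬ IsOpen (canGradedLocus k n (e + 1)) := by
  intro hopen
  let v : PLE k n (e + 1) := ⟨dpPower k i (e + 1), dpPower_mem_PLE i le_rfl⟩
  let w : PLE k n (e + 1) := ⟨dpPower k j e, dpPower_mem_PLE j e.le_succ⟩
  have hclosure : v ∈ closure (canGradedLocus k n (e + 1))ᶜ :=
    mem_closure_of_forall_add_smul_mem (w := w) fun t ht h =>
      not_isTwistedForm_dpPower_add_smul hij he ht (mem_canGradedLocus_iff.1 h)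
  rw [hopen.isClosed_compl.closure_eq] at hclosure
  exact hclosure (mem_canGradedLocus_iff.2 (isTwistedForm_dpPower i _))

theorem exists_mem_closure_canGradedLocus [Infinite k] (hij : i ≠ j) (he : 2 ≤ e) :
    ∃ f : PLE k n (e + 1), (f : Module.Dual k (S k n)) ∉ PLE k n e ∧
      f ∈ closure (canGradedLocus k n (e + 1)) ∧ f ∉ canGradedLocus k n (e + 1) := by
  refine ⟨⟨dpPower k i (e + 1) + dpPower k j e,
    add_mem (dpPower_mem_PLE i le_rfl) (dpPower_mem_PLE j e.le_succ)⟩, ?_, ?_, fun h => ?_⟩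
  · simpa only [one_smul] using dpPower_add_smul_notMem_PLE hij (1 : k)
  · exact mem_closure_of_forall_add_smul_mem (w := ⟨dpPower k j (e + 1), dpPower_mem_PLE j le_rfl⟩)
      fun s hs => mem_canGradedLocus_iff.2 (isTwistedForm_dpPower_add_add_smul hij e hs)
  · refine not_isTwistedForm_dpPower_add_smul hij he (one_ne_zero (α := k)) ?_
    rw [one_smul]
    exact mem_canGradedLocus_iff.1 h

end Examples

end CanonicallyGraded

end

theorem mainTheorem8_general (k : Type*) [Field k] [IsAlgClosed k] (n d : ℕ) (hn : 1 ≤ n) :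
    IsIrreducible (CanonicallyGraded.canGradedLocus k n d) ∧
    Topology.IsConstructible (CanonicallyGraded.canGradedLocus k n d) ∧
    (2 ≤ n → 3 ≤ d →
      ¬ IsOpen (CanonicallyGraded.canGradedLocus k n d) ∧
      ∃ f : CanonicallyGraded.PLE k n d,
        (f : Module.Dual k (CanonicallyGraded.S k n)) ∉ CanonicallyGraded.PLE k n (d - 1) ∧
        f ∈ closure (CanonicallyGraded.canGradedLocus k n d) ∧
        f ∉ CanonicallyGraded.canGradedLocus k n d) := by
  have : Infinite k := IsAlgClosed.instInfinite
  refine ⟨CanonicallyGraded.isIrreducible_canGradedLocus ⟨0, hn⟩,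
    CanonicallyGraded.isConstructible_canGradedLocus, fun hn₂ hd => ?_⟩
  obtain ⟨e, rfl⟩ := Nat.exists_eq_add_of_le' (show 1 ≤ d by omega)
  have he : 2 ≤ e := Nat.le_of_succ_le_succ hd
  obtain ⟨i, j, hij⟩ := Fin.nontrivial_iff_two_le.2 hn₂
  exact ⟨CanonicallyGraded.not_isOpen_canGradedLocus hij he,
    CanonicallyGraded.exists_mem_closure_canGradedLocus hij he⟩

theorem mainTheorem8 (k : Type*) [Field k] [IsAlgClosed k] (n d : ℕ) (hn : 1 ≤ n)
    (hchar : ringChar k = 0 ∨ d < ringChar k) :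
    IsIrreducible (CanonicallyGraded.canGradedLocus k n d) ∧
    Topology.IsConstructible (CanonicallyGraded.canGradedLocus k n d) ∧
    (n = 2 → d = 5 →
      ¬ IsClosed (CanonicallyGraded.canGradedLocus k n d) ∧
      ∃ f : CanonicallyGraded.PLE k n d,
        (f : Module.Dual k (CanonicallyGraded.S k n)) ∉ CanonicallyGraded.PLE k n 4 ∧
        f ∈ closure (CanonicallyGraded.canGradedLocus k n d) ∧
        f ∉ CanonicallyGraded.canGradedLocus k n d) ∧
    (n = 2 → 9 ≤ d → ¬ IsOpen (CanonicallyGraded.canGradedLocus k n d)) := by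
  obtain ⟨hirr, hcons, hex⟩ := mainTheorem8_general k n d hn
  refine ⟨hirr, hcons, ?_, fun hn₂ hd => (hex hn₂.ge (by omega)).1⟩
  rintro rfl rfl
  obtain ⟨f, hf, hcl, hfG⟩ := (hex le_rfl (by norm_num)).2
  exact ⟨fun h => hfG (h.closure_eq ▸ hcl), f, hf, hcl, hfG⟩
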